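/- Let $d\ge 1$ and let $\mathsf g(x)=-\log|x|$ if $d\in\{1,2\}$ (the logarithmic cases) and $\mathsf g(x)=|x|^{2-d}$ if $d\ge 3$ (the Coulomb case), for $x\in\mathbb R^d\setminus\{0\}$, with $\mathsf g(0)=+\infty$. For $V:\mathbb R^d\to\mathbb R$ and a probability measure $\mu$ on $\mathbb R^d$ put $$\mathcal I_V(\mu)=\iint \mathsf g(x-y)\,d\mu(x)\,d\mu(y)+\int V\,d\mu ,$$ say that $\mu$ has finite energy if both integrals converge absolutely, and call a probability measure $\mu_V$ an equilibrium measure of $V$ if it has finite energy and minimizes $\mathcal I_V$ among all probability measures of finite energy. For $\beta>0$ and $N\ge1$ let $$\mathcal H_N(x_1,\dots,x_N)=\sum_{i\ne j}\mathsf g(x_i-x_j)+N\sum_{i=1}^N V(x_i),\qquad Z_{N,\beta}=\int_{(\mathbb R^d)^N}\exp\Big(-\tfrac{\beta}{2}N^{\min(\frac2d-1,0)}\mathcal H_N(\vec X_N)\Big)\,d\vec X_N .$$ Assumption (A3) for $V$ and $\beta$ says that for all $N$ large enough $$\int_{\mathbb R^d} e^{-\beta N\left(\frac{V(x)}2-\log|x|\right)}dx<\infty\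 \text{ if } d\in\{1,2\},\qquad \int_{\mathbb R^d} e^{-\frac\beta2 N V(x)}dx<\infty\ \text{ if } d\ge 3 .$$ Corollary 3.8. Let $\mu_V$ be a probability measure on $\mathbb R^d$ with an $L^\infty$ density. There is a constant $C$, depending only on $\mu_V$ and $d$, such that for every continuous $V$ of which $\mu_V$ is an equilibrium measure and for every $\beta>0$ such that (A3) holds, for all $N$ large enough (depending on $V$ and $\beta$), $0<Z_{N,\beta}<\infty$ and $$\log Z_{N,\beta}\le-\frac\beta2\,N^{\min(2,\frac2d+1)}\,\mathcal I_V(\mu_V)+\Big(\frac{\beta}{2d}N\log N\Big)\mathbf 1_{d\in\{1,2\}}+C(1+\beta)N .$$ -/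

import Mathlib

open MeasureTheory Filter

namespace LogCoulombGas

/-- The Euclidean space of dimension `d`. -/
abbrev Space (d : ℕ) : Type := EuclideanSpace ℝ (Fin d)

/-- The pair interaction: `-log |x|` in dimensions one and two, the Coulomb kernel
`|x| ^ (2 - d)` in dimensions `d ≥ 3`. At the origin the mathematical value is `+∞`; the real
value taken here at that single point is never used: configurations with coinciding points are
negligible, and measures with atoms are declared to have infinite energy below. -/
noncomputable def kernel (d : ℕ) (x : Space d) : ℝ :=
  if d ≤ 2 then -Real.log ‖x‖ else ‖x‖ ^ (2 - (d : ℝ))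

/-- The Hamiltonian `∑_{i ≠ j} g (x i - x j) + N ∑ i, V (x i)`. -/
noncomputable def hamiltonian {d : ℕ} (V : Space d → ℝ) (N : ℕ) (X : Fin N → Space d) : ℝ :=
  (∑ i, ∑ j, if i ≠ j then kernel d (X i - X j) else 0) + (N : ℝ) * ∑ i, V (X i)

/-- The (unnormalized) Gibbs weight `exp (-(β/2) N ^ min (2/d - 1, 0) H_N)`. -/
noncomputable def gibbsWeight {d : ℕ} (V : Space d → ℝ) (β : ℝ) (N : ℕ)
    (X : Fin N → Space d) : ℝ :=
  Real.exp (-(β / 2) * (N : ℝ) ^ min (2 / (d : ℝ) - 1) 0 * hamiltonian V N X)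

/-- The partition function, an integral over `(ℝ^d)^N` for Lebesgue measure. -/
noncomputable def partitionFunction {d : ℕ} (V : Space d → ℝ) (β : ℝ) (N : ℕ) : ℝ :=
  ∫ X : Fin N → Space d, gibbsWeight V β N X

/-- The mean-field energy `∬ g (x - y) dμ(x) dμ(y) + ∫ V dμ`
(meaningful for measures of finite energy, see `HasFiniteEnergy`). -/
noncomputable def energy {d : ℕ} (V : Space d → ℝ) (μ : Measure (Space d)) : ℝ :=
  (∫ p : Space d × Space d, kernel d (p.1 - p.2) ∂(μ.prod μ)) + ∫ x, V x ∂μ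

/-- Both integrals in the mean-field energy converge absolutely. As the kernel is `+∞` at the
origin, this entails that `μ` has no atoms. -/
structure HasFiniteEnergy {d : ℕ} (V : Space d → ℝ) (μ : Measure (Space d)) : Prop where
  noAtoms : ∀ x, μ {x} = 0
  integrable_kernel :
    Integrable (fun p : Space d × Space d => kernel d (p.1 - p.2)) (μ.prod μ)
  integrable_potential : Integrable V μ

/-- `μ` is an equilibrium measure for `V`: a probability measure of finite energy that minimizes
the mean-field energy among probability measures. Uniqueness of the minimizer and compactness of
its support are not required. -/
structure IsEquilibriumMeasure {d : ℕ} (V : Space d → ℝ) (μ : Measure (Space d)) : Prop where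
  isProbabilityMeasure : IsProbabilityMeasure μ
  hasFiniteEnergy : HasFiniteEnergy V μ
  energy_le : ∀ ν : Measure (Space d), IsProbabilityMeasure ν → HasFiniteEnergy V ν →
    energy V μ ≤ energy V ν

/-- `μ` has an `L^∞` density with respect to Lebesgue measure. -/
def HasBoundedDensity {d : ℕ} (μ : Measure (Space d)) : Prop :=
  ∃ ρ : Space d → ℝ, MemLp ρ ⊤ volume ∧ (∀ᵐ x, 0 ≤ ρ x) ∧
    μ = volume.withDensity (fun x => ENNReal.ofReal (ρ x))

/-- The integrability assumption on the potential at inverse temperature `β`: for `N` large,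
`exp (-β N (V/2 - log |x|))` is integrable in dimensions one and two, and
`exp (-(β/2) N V)` is integrable in dimensions `d ≥ 3`. -/
def ExpIntegrable {d : ℕ} (V : Space d → ℝ) (β : ℝ) : Prop :=
  ∀ᶠ N : ℕ in atTop,
    if d ≤ 2 then
      Integrable (fun x : Space d => Real.exp (-β * (N : ℝ) * (V x / 2 - Real.log ‖x‖))) volume
    else
      Integrable (fun x : Space d => Real.exp (-(β / 2) * (N : ℝ) * V x)) volume

end LogCoulombGas

/-! Write ζ for `effectivePotential V μ`. Completing the square around Nμ splits the Hamiltonian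
exactly (`hamiltonian_eq`) into N² times the mean-field energy, plus 2N ∑ ζ(x_i), plus the
interaction F of the neutral discrepancy ∑ δ_{x_i} − Nμ with its diagonal removed. Minimality of μ
gives ζ ≥ 0 almost everywhere and ζ = 0 μ-almost everywhere.

F is bounded below by smearing. The kernel is a constant plus a superposition of Gaussians
exp(−t|x|²), renormalized at small t (`exists_kernel_eq`). Scales t > T form a nonnegative tail of
small L¹ norm, harmless because μ has a bounded density; restoring the diagonal costs N g_T(0),
where g_T is the truncated kernel. What remains is the truncated energy of the discrepancy,
nonnegative because Gaussians are positive definite (`gaussEnergy_posDef`, `nextOrderEnergy_ge`).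
For T = N^(2/d), the inverse square of the interparticle distance, every error is O(N) after the
temperature scaling, except (N log N)/d when d ≤ 2.

Discarding the truncated energy would leave (∫ exp(−tζ))^N, whose base J depends on V and β.
Instead, tested against a Lipschitz function f with values in [0, 1] and ∫ f dμ close to 1, it
yields a factor exp(−M ∑ (1 − f(x_i))) for any fixed M, at the price exp(3N)
(`eventually_truncDiscrepancy_penalizes`). With f supported in an open A slightly larger than the
set S where the density is positive, and M = 1 + J, the one-particle integral is at most |A| +
exp(−M) J ≤ |S| + 2, which depends on μ only. -/

namespace LogCoulombGas

open Set Real Topology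

variable {d : ℕ}

/-! ### The kernel as a mixture of Gaussians. -/

/-- The exponent of the weight in the representation of the kernel as a mixture of Gaussians. -/
noncomputable def mixExponent (d : ℕ) : ℝ := if d ≤ 2 then -1 else (d : ℝ) / 2 - 2

/-- The normalization of the weight in the representation of the kernel as a mixture of
Gaussians. -/
noncomputable def mixConst (d : ℕ) : ℝ := if d ≤ 2 then 1 / 2 else 1 / Real.Gamma ((d : ℝ) / 2 - 1)

/-- The weight `c t ^ p` such that `g = κ + ∫ (exp (-t |x|²) - 1_{t < 1}) c t ^ p dt`. -/
noncomputable def mixWeight (d : ℕ) (t : ℝ) : ℝ := mixConst d * t ^ mixExponent d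

/-- The contribution of scale `t` to the renormalized Gaussian mixture. -/
noncomputable def mixTerm (d : ℕ) (x : Space d) (t : ℝ) : ℝ :=
  mixWeight d t * (exp (-t * ‖x‖ ^ 2) - if t < 1 then 1 else 0)

/-- The kernel truncated at scale `T`. -/
noncomputable def truncKernel (d : ℕ) (T : ℝ) (x : Space d) : ℝ :=
  ∫ t in Ioc 0 T, mixTerm d x t

/-- What is left out by `truncKernel`. -/
noncomputable def tailKernel (d : ℕ) (T : ℝ) (x : Space d) : ℝ :=
  ∫ t in Ioi T, mixWeight d t * exp (-t * ‖x‖ ^ 2)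

/-- The growth of the kernel at infinity. -/
noncomputable def growth (d : ℕ) (x : Space d) : ℝ := if d ≤ 2 then log (1 + ‖x‖) else 0


lemma mixConst_pos (d : ℕ) : 0 < mixConst d := by
  unfold mixConst
  split_ifs with h
  · norm_num
  · have : (3 : ℝ) ≤ d := by exact_mod_cast (by omega : 3 ≤ d)
    exact one_div_pos.2 (Gamma_pos_of_pos (by linarith))

lemma mixWeight_nonneg {t : ℝ} (ht : 0 ≤ t) : 0 ≤ mixWeight d t :=
  mul_nonneg (mixConst_pos d).le (rpow_nonneg ht _)

lemma mixWeight_pos {t : ℝ} (ht : 0 < t) : 0 < mixWeight d t :=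
  mul_pos (mixConst_pos d) (rpow_pos_of_pos ht _)

lemma measurable_mixWeight : Measurable (mixWeight d) := by
  unfold mixWeight; fun_prop

lemma measurable_mixTerm_uncurry :
    Measurable (fun q : Space d × ℝ => mixTerm d q.1 q.2) := by
  unfold mixTerm
  refine (measurable_mixWeight.comp measurable_snd).mul (Measurable.sub (by fun_prop) ?_)
  exact Measurable.ite (measurableSet_lt measurable_snd measurable_const) measurable_const
    measurable_const

lemma measurable_mixTerm (x : Space d) : Measurable (mixTerm d x) :=
  measurable_mixTerm_uncurry.comp (measurable_const.prodMk measurable_id)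

lemma growth_nonneg (x : Space d) : 0 ≤ growth d x := by
  unfold growth
  split_ifs
  · exact log_nonneg (by linarith [norm_nonneg x])
  · rfl

lemma measurable_growth : Measurable (growth d) := by
  unfold growth
  split_ifs <;> fun_prop

lemma growth_sub_le (x y : Space d) : growth d (x - y) ≤ growth d x + growth d y := by
  unfold growth
  split_ifs
  · have hx := norm_nonneg x
    have hy := norm_nonneg y
    rw [← log_mul (by positivity) (by positivity)]
    apply log_le_log (by positivity)
    nlinarith [norm_sub_le x y, mul_nonneg hx hy]
  · simp

lemma neg_growth_le_kernel (x : Space d) : -growth d x ≤ kernel d x := by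
  unfold growth kernel
  split_ifs
  · by_cases hx : x = 0
    · simp [hx]
    · have : 0 < ‖x‖ := norm_pos_iff.2 hx
      exact neg_le_neg (log_le_log this (by linarith))
  · simpa using rpow_nonneg (norm_nonneg x) _

lemma measurable_kernel : Measurable (kernel d) := by
  unfold kernel
  split_ifs <;> fun_prop

/-- The weight 1/(2t) is not integrable at 0, so the cancellation in 1 − exp(−u) ≤ 2u/(1 + u) is
needed for t < 1; the summand 1 covers t ≥ 1. The bound has primitive log(1 + t|x|²) + t, whence the
logarithmic growth. -/
lemma abs_mixTerm_le_of_le_two (hd : d ≤ 2) (x : Space d) {t : ℝ} (ht : 0 < t) :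
    |mixTerm d x t| ≤ ‖x‖ ^ 2 / (1 + t * ‖x‖ ^ 2) + 1 := by
  have hw : mixWeight d t = 1 / 2 * t⁻¹ := by
    simp [mixWeight, mixConst, mixExponent, hd, rpow_neg_one]
  have ha : 0 ≤ ‖x‖ ^ 2 := by positivity
  set a := ‖x‖ ^ 2
  have hta : 0 ≤ t * a := by positivity
  have he : exp (-t * a) ≤ 1 := by
    rw [exp_le_one_iff]; nlinarith
  have he0 := exp_pos (-t * a)
  have hfrac : 0 ≤ a / (1 + t * a) := by positivity
  unfold mixTerm
  rw [hw, abs_mul, abs_of_nonneg (by positivity)]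
  split_ifs with h1
  · rw [abs_of_nonpos (by linarith)]
    have key : 1 - exp (-t * a) ≤ 2 * (t * a) / (1 + t * a) := by
      rw [le_div_iff₀ (by positivity)]
      have h2 : 1 - t * a ≤ exp (-t * a) := by
        have := add_one_le_exp (-t * a); linarith
      rcases le_total (t * a) 1 with h | h <;> nlinarith
    calc 1 / 2 * t⁻¹ * -(exp (-t * a) - 1) ≤ 1 / 2 * t⁻¹ * (2 * (t * a) / (1 + t * a)) := by
          gcongr; linarith
      _ = a / (1 + t * a) := by field_simp
      _ ≤ _ := by linarith
  · rw [sub_zero, abs_of_pos he0]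
    have : t⁻¹ ≤ 1 := inv_le_one_of_one_le₀ (by linarith)
    nlinarith [mul_le_mul this he he0.le zero_le_one]

lemma abs_mixTerm_le (x : Space d) {t : ℝ} (ht : 0 < t) : |mixTerm d x t| ≤ mixWeight d t := by
  have he : exp (-t * ‖x‖ ^ 2) ≤ 1 := by
    rw [exp_le_one_iff]; nlinarith [sq_nonneg ‖x‖]
  have he0 := exp_pos (-t * ‖x‖ ^ 2)
  unfold mixTerm
  rw [abs_mul, abs_of_nonneg (mixWeight_nonneg ht.le)]
  apply mul_le_of_le_one_right (mixWeight_nonneg ht.le)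
  split_ifs <;> rw [abs_le] <;> constructor <;> linarith

lemma integrableOn_mixWeight_of_three_le (hd : ¬ d ≤ 2) (T : ℝ) :
    IntegrableOn (mixWeight d) (Ioc 0 T) := by
  rcases le_total T 0 with hT | hT
  · simp [Ioc_eq_empty_of_le hT]
  rw [← intervalIntegrable_iff_integrableOn_Ioc_of_le hT]
  refine (intervalIntegral.intervalIntegrable_rpow' ?_).const_mul _
  have : (3 : ℝ) ≤ d := by exact_mod_cast (by omega : 3 ≤ d)
  simp only [mixExponent, hd, if_false]
  linarith

lemma integrableOn_dominating {a : ℝ} (ha : 0 ≤ a) (T : ℝ) :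
    IntegrableOn (fun t => a / (1 + t * a) + 1) (Ioc 0 T) := by
  refine IntegrableOn.mono_set (ContinuousOn.integrableOn_Icc (a := 0) (b := T) ?_) Ioc_subset_Icc_self
  refine ContinuousOn.add (ContinuousOn.div (by fun_prop) (by fun_prop) ?_) (by fun_prop)
  intro t ht
  have := ht.1
  positivity

lemma integral_dominating {a : ℝ} (ha : 0 ≤ a) {T : ℝ} (hT : 0 ≤ T) :
    ∫ t in Ioc 0 T, (a / (1 + t * a) + 1) = log (1 + T * a) + T := by
  rw [← intervalIntegral.integral_of_le hT]
  rw [intervalIntegral.integral_eq_sub_of_hasDerivAt (f := fun t => log (1 + t * a) + t)]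
  · simp
  · intro t ht
    rw [uIcc_of_le hT] at ht
    have h0 : 0 ≤ t := ht.1
    have h := ((((hasDerivAt_id t).mul_const a).const_add 1).log
      (show 1 + id t * a ≠ 0 by simp only [id]; positivity)).add (hasDerivAt_id t)
    exact (by simpa using h : HasDerivAt ((fun y => log (1 + y * a)) + id) (a / (1 + t * a) + 1) t)
  · rw [intervalIntegrable_iff_integrableOn_Ioc_of_le hT]
    exact integrableOn_dominating ha T

lemma integrableOn_mixTerm (x : Space d) (T : ℝ) : IntegrableOn (mixTerm d x) (Ioc 0 T) := by
  by_cases hd : d ≤ 2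
  · refine Integrable.mono' (integrableOn_dominating (sq_nonneg ‖x‖) T)
      (measurable_mixTerm x).aestronglyMeasurable ?_
    filter_upwards [ae_restrict_mem measurableSet_Ioc] with t ht
    exact abs_mixTerm_le_of_le_two hd x ht.1
  · refine Integrable.mono' (integrableOn_mixWeight_of_three_le hd T)
      (measurable_mixTerm x).aestronglyMeasurable ?_
    filter_upwards [ae_restrict_mem measurableSet_Ioc] with t ht
    exact abs_mixTerm_le x ht.1

lemma exists_integral_abs_mixTerm_le (d : ℕ) {T : ℝ} (hT : 0 ≤ T) :
    ∃ C, 0 ≤ C ∧ ∀ x : Space d, ∫ t in Ioc 0 T, |mixTerm d x t| ≤ C * (1 + growth d x) := by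
  by_cases hd : d ≤ 2
  · refine ⟨2 * T + 2, by linarith, fun x => ?_⟩
    have ha : 0 ≤ ‖x‖ ^ 2 := by positivity
    have h1 : ∫ t in Ioc 0 T, |mixTerm d x t| ≤ log (1 + T * ‖x‖ ^ 2) + T := by
      rw [← integral_dominating ha hT]
      refine setIntegral_mono_on (integrableOn_mixTerm x T).abs (integrableOn_dominating ha T)
        measurableSet_Ioc fun t ht => abs_mixTerm_le_of_le_two hd x ht.1
    have h2 : log (1 + T * ‖x‖ ^ 2) ≤ T + 2 * growth d x := by
      have hx := norm_nonneg x
      have h3 : log (1 + T * ‖x‖ ^ 2) ≤ log ((1 + T) * (1 + ‖x‖) ^ 2) := by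
        apply log_le_log (by positivity)
        nlinarith [mul_nonneg hT hx]
      rw [log_mul (by positivity) (by positivity), log_pow] at h3
      have h4 := log_le_sub_one_of_pos (show 0 < 1 + T by linarith)
      simp only [growth, hd, if_true]
      push_cast at h3
      linarith
    nlinarith [growth_nonneg x, mul_nonneg hT (growth_nonneg x)]
  · refine ⟨∫ t in Ioc 0 T, mixWeight d t, setIntegral_nonneg measurableSet_Ioc
      fun t ht => mixWeight_nonneg ht.1.le, fun x => ?_⟩
    have h0 : growth d x = 0 := by simp [growth, hd]
    rw [h0, add_zero, mul_one]
    exact setIntegral_mono_on (integrableOn_mixTerm x T).abs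
      (integrableOn_mixWeight_of_three_le hd T) measurableSet_Ioc fun t ht => abs_mixTerm_le x ht.1

lemma integrableOn_tail (x : Space d) (hx : x ≠ 0) {T : ℝ} (hT : 1 ≤ T) :
    IntegrableOn (fun t => mixWeight d t * exp (-t * ‖x‖ ^ 2)) (Ioi T) := by
  have ha : 0 < ‖x‖ ^ 2 := by have := norm_pos_iff.2 hx; positivity
  -- The exponent can be −1, too singular for a Gamma integral on (0, ∞); since t ≥ 1 here it may be
  -- raised to its maximum with 0.
  have h1 : IntegrableOn (fun t : ℝ => t ^ (max (mixExponent d) 0) * exp (-(‖x‖ ^ 2) * t ^ (1 : ℝ)))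
      (Ioi 0) :=
    integrableOn_rpow_mul_exp_neg_mul_rpow (lt_of_lt_of_le (by norm_num) (le_max_right _ _))
      one_pos ha
  refine Integrable.mono' ((h1.mono_set (Ioi_subset_Ioi (by linarith : (0 : ℝ) ≤ T))).const_mul
    (mixConst d)) ?_ ?_
  · exact (measurable_mixWeight.mul (by fun_prop)).aestronglyMeasurable
  · filter_upwards [ae_restrict_mem measurableSet_Ioi] with t ht
    have ht1 : 1 ≤ t := hT.trans (le_of_lt ht)
    have := mixWeight_nonneg (d := d) (by linarith : 0 ≤ t)
    rw [norm_of_nonneg (by positivity), mixWeight, mul_assoc, rpow_one,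
      show -t * ‖x‖ ^ 2 = -(‖x‖ ^ 2) * t by ring]
    gcongr
    · exact (mixConst_pos d).le
    · exact le_max_left _ _

lemma mixTerm_eq_of_one_le (x : Space d) {t : ℝ} (ht : 1 ≤ t) :
    mixTerm d x t = mixWeight d t * exp (-t * ‖x‖ ^ 2) := by
  simp [mixTerm, not_lt.2 ht]

lemma integrableOn_mixTerm_Ioi (x : Space d) (hx : x ≠ 0) :
    IntegrableOn (mixTerm d x) (Ioi 0) := by
  rw [← Ioc_union_Ioi_eq_Ioi zero_le_one]
  refine (integrableOn_mixTerm x 1).union ?_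
  refine (integrableOn_tail x hx le_rfl).congr_fun (fun t ht => ?_) measurableSet_Ioi
  exact (mixTerm_eq_of_one_le x (le_of_lt ht)).symm

lemma truncKernel_add_tailKernel (x : Space d) (hx : x ≠ 0) {T : ℝ} (hT : 1 ≤ T) :
    truncKernel d T x + tailKernel d T x = ∫ t in Ioi 0, mixTerm d x t := by
  have h : ∫ t in Ioi T, mixTerm d x t = tailKernel d T x :=
    setIntegral_congr_fun measurableSet_Ioi fun t ht =>
      mixTerm_eq_of_one_le x (hT.trans (le_of_lt ht))
  rw [← Ioc_union_Ioi_eq_Ioi (show (0 : ℝ) ≤ T by linarith),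
    setIntegral_union Ioc_disjoint_Ioi_same measurableSet_Ioi (integrableOn_mixTerm x T)
      ((integrableOn_mixTerm_Ioi x hx).mono_set (Ioi_subset_Ioi (by linarith))), h, truncKernel]

lemma integral_inv_mul_exp_sub_exp {a b : ℝ} (ha : 0 < a) (hb : 0 < b)
    (hint : IntegrableOn (fun t : ℝ => t⁻¹ • (exp (-(a * t)) - exp (-(b * t)))) (Ioi 0)) :
    ∫ t in Ioi (0 : ℝ), t⁻¹ • (exp (-(a * t)) - exp (-(b * t))) = log (b / a) := by
  have hc : Continuous fun x : ℝ => exp (-x) := by fun_prop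
  have h := Frullani.integral_Ioi_eq (f := fun x : ℝ => exp (-x)) (L := 1) (R := 0)
    (hc.locallyIntegrable.locallyIntegrableOn _) ha hb
    (by simpa using (hc.tendsto 0).mono_left nhdsWithin_le_nhds)
    (tendsto_exp_neg_atTop_nhds_zero) hint
  simpa using h

lemma exists_unit (hd : 1 ≤ d) : ∃ e : Space d, ‖e‖ = 1 := by
  have : Nonempty (Fin d) := ⟨⟨0, by omega⟩⟩
  exact ⟨EuclideanSpace.single (Classical.arbitrary (Fin d)) 1, by simp⟩

/-- The kernel is, up to a constant, a mixture of Gaussians. -/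
lemma exists_kernel_eq (hd : 1 ≤ d) : ∃ κ : ℝ, ∀ (T : ℝ) (_ : 1 ≤ T) (x : Space d) (_ : x ≠ 0),
    kernel d x = κ + truncKernel d T x + tailKernel d T x := by
  obtain ⟨e, he⟩ := exists_unit hd
  have he0 : e ≠ 0 := by rw [← norm_pos_iff, he]; exact one_pos
  by_cases h2 : d ≤ 2
  -- The logarithm vanishes on unit vectors, so κ normalizes at `e`; the indicators of t < 1 cancel
  -- in the difference and a Frullani integral remains.
  · refine ⟨-∫ t in Ioi 0, mixTerm d e t, fun T hT x hx => ?_⟩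
    have hxp := norm_pos_iff.2 hx
    rw [add_assoc, truncKernel_add_tailKernel x hx hT, neg_add_eq_sub,
      ← integral_sub (integrableOn_mixTerm_Ioi x hx) (integrableOn_mixTerm_Ioi e he0)]
    have hfun : ∀ t, mixTerm d x t - mixTerm d e t =
        1 / 2 * (t⁻¹ • (exp (-(‖x‖ ^ 2 * t)) - exp (-(1 * t)))) := by
      intro t
      simp only [mixTerm, mixWeight, mixConst, mixExponent, h2, if_true, rpow_neg_one, he,
        smul_eq_mul]
      ring_nf
    have hint := (integrableOn_mixTerm_Ioi x hx).sub (integrableOn_mixTerm_Ioi e he0)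
    have hint' : IntegrableOn (fun t : ℝ => t⁻¹ • (exp (-(‖x‖ ^ 2 * t)) - exp (-(1 * t))))
        (Ioi 0) := by
      refine (hint.const_mul 2).congr (Eventually.of_forall fun t => ?_)
      simp only [Pi.sub_apply]
      rw [hfun]; ring
    simp_rw [hfun]
    rw [integral_const_mul, integral_inv_mul_exp_sub_exp (by positivity) one_pos hint']
    simp only [kernel, h2, if_true]
    rw [one_div, one_div, log_inv, log_pow]
    push_cast
    ring
  · have h3 : (3 : ℝ) ≤ d := by exact_mod_cast (by omega : 3 ≤ d)
    -- The weight is integrable at 0 when d ≥ 3, so κ simply restores the subtracted part and leaves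
    -- a Gamma integral.
    refine ⟨∫ t in Ioc 0 1, mixWeight d t, fun T hT x hx => ?_⟩
    have hxp := norm_pos_iff.2 hx
    rw [add_assoc, truncKernel_add_tailKernel x hx hT]
    have hw := integrableOn_mixWeight_of_three_le h2 1
    have hsub : Ioc (0 : ℝ) 1 ⊆ Ioi 0 := Ioc_subset_Ioi_self
    have hwi : Integrable ((Ioc (0 : ℝ) 1).indicator (mixWeight d)) (volume.restrict (Ioi 0)) :=
      (integrable_indicator_iff measurableSet_Ioc).2 (hw.mono_measure Measure.restrict_le_self)
    have e1 : ∫ t in Ioc 0 1, mixWeight d t =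
        ∫ t in Ioi 0, (Ioc (0 : ℝ) 1).indicator (mixWeight d) t := by
      rw [setIntegral_indicator measurableSet_Ioc, inter_eq_self_of_subset_right hsub]
    rw [e1, ← integral_add hwi (integrableOn_mixTerm_Ioi x hx)]
    have e2 : ∫ t in Ioi 0, ((Ioc (0 : ℝ) 1).indicator (mixWeight d) t + mixTerm d x t) =
        ∫ t in Ioi 0, mixConst d * (t ^ ((d : ℝ) / 2 - 1 - 1) * exp (-(‖x‖ ^ 2 * t))) := by
      refine integral_congr_ae ?_
      filter_upwards [ae_restrict_mem measurableSet_Ioi,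
        compl_mem_ae_iff.2 (measure_singleton (1 : ℝ))] with t ht ht1
      have ht0 : 0 < t := ht
      have hmw : mixWeight d t = mixConst d * t ^ ((d : ℝ) / 2 - 1 - 1) := by
        simp only [mixWeight, mixExponent, h2, if_false]; ring_nf
      have hexp : -t * ‖x‖ ^ 2 = -(‖x‖ ^ 2 * t) := by ring
      rcases lt_or_gt_of_ne (show t ≠ 1 from ht1) with h | h
      · rw [indicator_of_mem (mem_Ioc.2 ⟨ht0, h.le⟩), mixTerm, if_pos h, hmw, hexp]; ring
      · rw [indicator_of_notMem (fun hm => absurd hm.2 (not_le.2 h)), mixTerm,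
          if_neg (not_lt.2 h.le), hmw, hexp]; ring
    rw [e2, integral_const_mul, Real.integral_rpow_mul_exp_neg_mul_Ioi (by linarith) (by positivity)]
    have hG : Gamma ((d : ℝ) / 2 - 1) ≠ 0 := (Gamma_pos_of_pos (by linarith)).ne'
    simp only [kernel, h2, if_false, mixConst]
    rw [one_div, one_div, mul_comm, mul_assoc, mul_inv_cancel₀ hG, mul_one, inv_rpow (by positivity),
      ← rpow_natCast, ← rpow_mul hxp.le, ← rpow_neg hxp.le]
    congr 1
    push_cast
    ring


/-! ### Mass of the tail kernel and size of the truncated kernel. -/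

lemma tailKernel_nonneg {T : ℝ} (hT : 0 ≤ T) (x : Space d) : 0 ≤ tailKernel d T x :=
  setIntegral_nonneg measurableSet_Ioi fun _ ht =>
    mul_nonneg (mixWeight_nonneg (hT.trans (le_of_lt ht))) (exp_pos _).le

lemma measurable_tailKernel (T : ℝ) : Measurable (tailKernel d T) := by
  have h : StronglyMeasurable (fun q : Space d × ℝ => mixWeight d q.2 * exp (-q.2 * ‖q.1‖ ^ 2)) :=
    ((measurable_mixWeight.comp measurable_snd).mul (by fun_prop)).stronglyMeasurable
  exact h.integral_prod_right'.measurable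

lemma measurable_truncKernel (T : ℝ) : Measurable (truncKernel d T) :=
  measurable_mixTerm_uncurry.stronglyMeasurable.integral_prod_right'.measurable

lemma integrable_exp_neg_mul_sq_norm {t : ℝ} (ht : 0 < t) :
    Integrable (fun x : Space d => exp (-t * ‖x‖ ^ 2)) := by
  -- A nonintegrable function would have integral 0 by convention, but the Gaussian integral is
  -- positive.
  by_contra h
  have h1 := GaussianFourier.integral_rexp_neg_mul_sq_norm (V := Space d) ht
  rw [integral_undef h] at h1
  exact (rpow_pos_of_pos (div_pos pi_pos ht) _).ne h1

lemma lintegral_exp_neg_mul_sq_norm {t : ℝ} (ht : 0 < t) :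
    ∫⁻ x : Space d, ENNReal.ofReal (exp (-t * ‖x‖ ^ 2)) =
      ENNReal.ofReal ((π / t) ^ ((d : ℝ) / 2)) := by
  rw [← ofReal_integral_eq_lintegral_ofReal (integrable_exp_neg_mul_sq_norm ht)
    (Eventually.of_forall fun x => (exp_pos _).le),
    GaussianFourier.integral_rexp_neg_mul_sq_norm ht]
  simp

/-- The decay exponent of the integral of the tail kernel. -/
lemma mixExponent_sub_lt (hd : 1 ≤ d) : mixExponent d - (d : ℝ) / 2 < -1 := by
  unfold mixExponent
  split_ifs with h
  · have : (1 : ℝ) ≤ d := by exact_mod_cast hd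
    linarith
  · linarith

lemma lintegral_tailKernel_le (hd : 1 ≤ d) {T : ℝ} (hT : 1 ≤ T) :
    ∫⁻ x : Space d, ENNReal.ofReal (tailKernel d T x) ≤
      ENNReal.ofReal (mixConst d * π ^ ((d : ℝ) / 2) *
        (-T ^ (mixExponent d - (d : ℝ) / 2 + 1) / (mixExponent d - (d : ℝ) / 2 + 1))) := by
  have hT0 : 0 < T := by linarith
  have hm : Measurable (fun q : Space d × ℝ =>
      ENNReal.ofReal (mixWeight d q.2 * exp (-q.2 * ‖q.1‖ ^ 2))) :=
    ENNReal.measurable_ofReal.comp ((measurable_mixWeight.comp measurable_snd).mul (by fun_prop))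
  have hp := mixExponent_sub_lt hd
  calc ∫⁻ x : Space d, ENNReal.ofReal (tailKernel d T x)
      ≤ ∫⁻ x : Space d, ∫⁻ t in Ioi T, ENNReal.ofReal (mixWeight d t * exp (-t * ‖x‖ ^ 2)) := by
        refine lintegral_mono fun x => ?_
        by_cases hi : IntegrableOn (fun t => mixWeight d t * exp (-t * ‖x‖ ^ 2)) (Ioi T)
        · rw [tailKernel, ofReal_integral_eq_lintegral_ofReal hi]
          filter_upwards [ae_restrict_mem measurableSet_Ioi] with t ht
          exact mul_nonneg (mixWeight_nonneg (hT0.le.trans (le_of_lt ht))) (exp_pos _).le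
        -- Where the integral diverges, as it does at the origin, `tailKernel` has the default value
        -- 0 and the inequality is trivial.
        · rw [tailKernel, integral_undef hi]; simp
    _ = ∫⁻ t in Ioi T, ∫⁻ x : Space d, ENNReal.ofReal (mixWeight d t * exp (-t * ‖x‖ ^ 2)) :=
        lintegral_lintegral_swap hm.aemeasurable
    _ = ∫⁻ t in Ioi T, ENNReal.ofReal (mixConst d * π ^ ((d : ℝ) / 2) *
          t ^ (mixExponent d - (d : ℝ) / 2)) := by
        refine setLIntegral_congr_fun measurableSet_Ioi fun t ht => ?_
        have ht0 : 0 < t := hT0.trans ht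
        have hw := mixWeight_nonneg (d := d) ht0.le
        simp_rw [ENNReal.ofReal_mul hw]
        rw [lintegral_const_mul _ (by fun_prop), lintegral_exp_neg_mul_sq_norm ht0,
          ← ENNReal.ofReal_mul hw, mixWeight, div_rpow pi_pos.le ht0.le, rpow_sub ht0]
        congr 1
        ring
    _ = _ := by
        rw [← ofReal_integral_eq_lintegral_ofReal]
        · rw [integral_const_mul, integral_Ioi_rpow_of_lt hp hT0]
        · exact (integrableOn_Ioi_rpow_of_lt hp hT0).const_mul _
        · filter_upwards [ae_restrict_mem measurableSet_Ioi] with t ht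
          have := mixConst_pos d
          have : 0 < t := hT0.trans ht
          positivity

/-- Integrating the Gaussian of scale t over space gives t^(−d/2), so by Tonelli only a power of t
has to be integrated beyond T. The minimum is d/2 for d ≤ 2 and 1 for d ≥ 3. -/
lemma exists_lintegral_tailKernel_le (hd : 1 ≤ d) :
    ∃ C : ℝ, 0 ≤ C ∧ ∀ T : ℝ, 1 ≤ T → ∫⁻ x : Space d, ENNReal.ofReal (tailKernel d T x) ≤
      ENNReal.ofReal (C * T ^ (-min 1 ((d : ℝ) / 2))) := by
  have hp := mixExponent_sub_lt hd
  have hexp : mixExponent d - (d : ℝ) / 2 + 1 = -min 1 ((d : ℝ) / 2) := by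
    unfold mixExponent
    split_ifs with h
    · have : (d : ℝ) ≤ 2 := by exact_mod_cast h
      rw [min_eq_right (by linarith)]; ring
    · have : (3 : ℝ) ≤ d := by exact_mod_cast (by omega : 3 ≤ d)
      rw [min_eq_left (by linarith)]; ring
  refine ⟨mixConst d * π ^ ((d : ℝ) / 2) * (-(mixExponent d - (d : ℝ) / 2 + 1)⁻¹), ?_, ?_⟩
  · have := mixConst_pos d
    have h2 : 0 ≤ -(mixExponent d - (d : ℝ) / 2 + 1)⁻¹ := by
      rw [neg_nonneg, inv_nonpos]; linarith
    positivity
  · intro T hT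
    refine (lintegral_tailKernel_le hd hT).trans (le_of_eq ?_)
    rw [← hexp]
    congr 1
    rw [div_eq_mul_inv]
    ring

/-- At the origin the renormalization cancels every scale below 1. -/
lemma truncKernel_zero_eq {T : ℝ} (hT : 1 ≤ T) :
    truncKernel d T 0 = ∫ t in (1 : ℝ)..T, mixWeight d t := by
  rw [intervalIntegral.integral_of_le hT, truncKernel,
    ← Ioc_union_Ioc_eq_Ioc zero_le_one hT, setIntegral_union
      (by rw [Set.disjoint_left]; exact fun t h1 h2 => absurd h1.2 (not_le.2 h2.1)) measurableSet_Ioc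
      (integrableOn_mixTerm 0 1)
      ((integrableOn_mixTerm 0 T).mono_set (Ioc_subset_Ioc_left zero_le_one))]
  have h1 : ∫ t in Ioc (0 : ℝ) 1, mixTerm d 0 t = 0 := by
    rw [integral_Ioc_eq_integral_Ioo]
    refine setIntegral_eq_zero_of_forall_eq_zero fun t ht => ?_
    simp [mixTerm, ht.2]
  rw [h1, zero_add]
  refine setIntegral_congr_fun measurableSet_Ioc fun t ht => ?_
  rw [mixTerm_eq_of_one_le _ ht.1.le]
  simp

/-- The self-interaction of one smeared point. For T = N^(2/d) it equals (log N)/d, the source of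
the N log N term. -/
lemma truncKernel_zero_of_le_two (hd : d ≤ 2) {T : ℝ} (hT : 1 ≤ T) :
    truncKernel d T 0 = 1 / 2 * log T := by
  rw [truncKernel_zero_eq hT]
  simp only [mixWeight, mixConst, mixExponent, hd, if_true, rpow_neg_one]
  rw [intervalIntegral.integral_const_mul, integral_inv_of_pos one_pos (by linarith)]
  simp

lemma exists_truncKernel_zero_le (hd : ¬ d ≤ 2) :
    ∃ C : ℝ, 0 ≤ C ∧ ∀ T : ℝ, 1 ≤ T → truncKernel d T 0 ≤ C * T ^ ((d : ℝ) / 2 - 1) := by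
  have h3 : (3 : ℝ) ≤ d := by exact_mod_cast (by omega : 3 ≤ d)
  have hq : 0 < (d : ℝ) / 2 - 1 := by linarith
  refine ⟨mixConst d / ((d : ℝ) / 2 - 1), (div_pos (mixConst_pos d) hq).le, fun T hT => ?_⟩
  rw [truncKernel_zero_eq hT]
  simp only [mixWeight, mixExponent, hd, if_false]
  rw [intervalIntegral.integral_const_mul, integral_rpow (Or.inl (by linarith)), one_rpow,
    show (d : ℝ) / 2 - 2 + 1 = (d : ℝ) / 2 - 1 by ring, div_mul_eq_mul_div, mul_div_assoc]
  have := mixConst_pos d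
  gcongr
  linarith

lemma abs_truncKernel_le {C T : ℝ} {x : Space d}
    (hC : ∫ t in Ioc 0 T, |mixTerm d x t| ≤ C * (1 + growth d x)) :
    |truncKernel d T x| ≤ C * (1 + growth d x) :=
  (abs_integral_le_integral_abs).trans hC

/-! ### Gaussian interactions: positive definiteness and approximation of test functions. -/

/-- The mutual Gaussian energy of two measures. -/
noncomputable def gaussEnergy (t : ℝ) (α γ : Measure (Space d)) : ℝ :=
  ∫ p, exp (-t * ‖p.1 - p.2‖ ^ 2) ∂(α.prod γ)

/-- The total mass of a Gaussian. -/
noncomputable def gaussMass (d : ℕ) (t : ℝ) : ℝ := ∫ z : Space d, exp (-t * ‖z‖ ^ 2)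

lemma gaussMass_eq {t : ℝ} (ht : 0 < t) : gaussMass d t = (π / t) ^ ((d : ℝ) / 2) := by
  rw [gaussMass, GaussianFourier.integral_rexp_neg_mul_sq_norm ht]
  simp

lemma gaussMass_pos {t : ℝ} (ht : 0 < t) : 0 < gaussMass d t := by
  rw [gaussMass_eq ht]; positivity

lemma gaussMass_anti {s t : ℝ} (hs : 0 < s) (hst : s ≤ t) : gaussMass d t ≤ gaussMass d s := by
  rw [gaussMass_eq hs, gaussMass_eq (hs.trans_le hst)]
  have : 0 ≤ π / t := div_nonneg pi_pos.le (hs.le.trans hst)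
  gcongr

lemma exp_neg_mul_sq_le_one {E : Type*} [NormedAddCommGroup E] {t : ℝ} (ht : 0 ≤ t) (x : E) :
    exp (-t * ‖x‖ ^ 2) ≤ 1 := by
  rw [exp_le_one_iff]; nlinarith [sq_nonneg ‖x‖]

lemma integrable_gauss_prod {t : ℝ} (ht : 0 ≤ t) (α γ : Measure (Space d)) [IsFiniteMeasure α]
    [IsFiniteMeasure γ] :
    Integrable (fun p : Space d × Space d => exp (-t * ‖p.1 - p.2‖ ^ 2)) (α.prod γ) :=
  (integrable_const (1 : ℝ)).mono' (by fun_prop) (Eventually.of_forall fun p => by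
    rw [norm_of_nonneg (exp_pos _).le]; exact exp_neg_mul_sq_le_one ht _)

lemma gaussEnergy_nonneg (t : ℝ) (α γ : Measure (Space d)) : 0 ≤ gaussEnergy t α γ :=
  integral_nonneg fun _ => (exp_pos _).le

lemma gaussEnergy_le {t : ℝ} (ht : 0 ≤ t) (α γ : Measure (Space d)) [IsFiniteMeasure α]
    [IsFiniteMeasure γ] : gaussEnergy t α γ ≤ α.real univ * γ.real univ := by
  calc gaussEnergy t α γ ≤ ∫ _p, (1 : ℝ) ∂(α.prod γ) :=
        integral_mono (integrable_gauss_prod ht α γ) (integrable_const _)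
          fun p => exp_neg_mul_sq_le_one ht _
    _ = _ := by
      rw [integral_const, smul_eq_mul, mul_one, ← univ_prod_univ, measureReal_prod_prod]

/-- By the parallelogram law, the product of Gaussians centered at x and y is a Gaussian in z
centered at their midpoint, times a Gaussian in x − y. -/
lemma exp_mul_exp_eq (t : ℝ) (x y z : Space d) :
    exp (-(2 * t) * ‖x - z‖ ^ 2) * exp (-(2 * t) * ‖y - z‖ ^ 2) =
      exp (-t * ‖x - y‖ ^ 2) * exp (-(4 * t) * ‖z - (2⁻¹ : ℝ) • (x + y)‖ ^ 2) := by
  rw [← exp_add, ← exp_add]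
  congr 1
  have h := parallelogram_law_with_norm ℝ (x - z) (y - z)
  have h1 : x - z - (y - z) = x - y := by abel
  have h2 : x - z + (y - z) = (-2 : ℝ) • (z - (2⁻¹ : ℝ) • (x + y)) := by
    rw [smul_sub, smul_smul]; norm_num; rw [two_smul]; abel
  rw [h1, h2, norm_smul, Real.norm_eq_abs, abs_neg, abs_two] at h
  linear_combination t * h

lemma integrable_gauss_mul_gauss {t : ℝ} (ht : 0 < t) (x y : Space d) :
    Integrable (fun z : Space d => exp (-(2 * t) * ‖x - z‖ ^ 2) * exp (-(2 * t) * ‖y - z‖ ^ 2)) := by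
  simp_rw [exp_mul_exp_eq]
  exact ((integrable_exp_neg_mul_sq_norm (by linarith : 0 < 4 * t)).comp_sub_right _).const_mul _

lemma integral_gauss_mul_gauss (t : ℝ) (x y : Space d) :
    ∫ z : Space d, exp (-(2 * t) * ‖x - z‖ ^ 2) * exp (-(2 * t) * ‖y - z‖ ^ 2) =
      exp (-t * ‖x - y‖ ^ 2) * gaussMass d (4 * t) := by
  simp_rw [exp_mul_exp_eq]
  rw [integral_const_mul, integral_sub_right_eq_self (fun z => exp (-(4 * t) * ‖z‖ ^ 2))]
  rfl

lemma integrable_gauss_triple {t : ℝ} (ht : 0 < t) (α γ : Measure (Space d)) [IsFiniteMeasure α]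
    [IsFiniteMeasure γ] :
    Integrable (fun q : (Space d × Space d) × Space d =>
      exp (-(2 * t) * ‖q.1.1 - q.2‖ ^ 2) * exp (-(2 * t) * ‖q.1.2 - q.2‖ ^ 2))
      ((α.prod γ).prod volume) := by
  rw [integrable_prod_iff (by fun_prop)]
  refine ⟨Eventually.of_forall fun p => integrable_gauss_mul_gauss ht p.1 p.2, ?_⟩
  simp_rw [norm_of_nonneg (mul_pos (exp_pos _) (exp_pos _)).le, integral_gauss_mul_gauss]
  exact (integrable_gauss_prod ht.le α γ).mul_const _

/-- The Gaussian potential of a measure. -/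
noncomputable def gaussPotential (t : ℝ) (α : Measure (Space d)) (z : Space d) : ℝ :=
  ∫ x, exp (-(2 * t) * ‖x - z‖ ^ 2) ∂α

lemma integrable_gaussPotential_mul {t : ℝ} (ht : 0 < t) (α γ : Measure (Space d))
    [IsFiniteMeasure α] [IsFiniteMeasure γ] :
    Integrable (fun z => gaussPotential t α z * gaussPotential t γ z) := by
  refine (integrable_gauss_triple ht α γ).integral_prod_right.congr (Eventually.of_forall fun z => ?_)
  exact integral_prod_mul (fun x => exp (-(2 * t) * ‖x - z‖ ^ 2))
    (fun y => exp (-(2 * t) * ‖y - z‖ ^ 2))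

/-- A Gaussian is, up to normalization, the convolution square of a narrower one. The mutual energy
is therefore an L² inner product of potentials, which makes positive definiteness evident. -/
lemma gaussEnergy_mul_gaussMass {t : ℝ} (ht : 0 < t) (α γ : Measure (Space d))
    [IsFiniteMeasure α] [IsFiniteMeasure γ] :
    gaussEnergy t α γ * gaussMass d (4 * t) =
      ∫ z, gaussPotential t α z * gaussPotential t γ z := by
  rw [gaussEnergy, ← integral_mul_const]
  simp_rw [← integral_gauss_mul_gauss]
  rw [integral_integral_swap (integrable_gauss_triple ht α γ)]
  refine integral_congr_ae (Eventually.of_forall fun z => ?_)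
  exact integral_prod_mul (fun x => exp (-(2 * t) * ‖x - z‖ ^ 2))
    (fun y => exp (-(2 * t) * ‖y - z‖ ^ 2))

/-- The Gaussian interaction is positive definite. -/
theorem gaussEnergy_posDef {t : ℝ} (ht : 0 < t) {ι : Type*} [Fintype ι] (c : ι → ℝ)
    (ν : ι → Measure (Space d)) [∀ i, IsFiniteMeasure (ν i)] :
    0 ≤ ∑ i, ∑ j, c i * c j * gaussEnergy t (ν i) (ν j) := by
  refine nonneg_of_mul_nonneg_left ?_ (gaussMass_pos (d := d) (by linarith : 0 < 4 * t))
  have h : (∑ i, ∑ j, c i * c j * gaussEnergy t (ν i) (ν j)) * gaussMass d (4 * t) =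
      ∫ z, (∑ i, c i * gaussPotential t (ν i) z) ^ 2 := by
    have hint : ∀ i j, Integrable (fun z => c i * c j *
        (gaussPotential t (ν i) z * gaussPotential t (ν j) z)) := fun i j =>
      (integrable_gaussPotential_mul ht (ν i) (ν j)).const_mul _
    have hz : ∀ z, (∑ i, c i * gaussPotential t (ν i) z) ^ 2 =
        ∑ i, ∑ j, c i * c j * (gaussPotential t (ν i) z * gaussPotential t (ν j) z) := by
      intro z
      rw [sq, Finset.sum_mul_sum]
      exact Finset.sum_congr rfl fun i _ => Finset.sum_congr rfl fun j _ => by ring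
    simp_rw [hz]
    rw [integral_finsetSum _ fun i _ => integrable_finsetSum _ fun j _ => hint i j]
    simp_rw [integral_finsetSum _ fun j _ => hint _ j, integral_const_mul,
      ← gaussEnergy_mul_gaussMass ht, Finset.sum_mul]
    exact Finset.sum_congr rfl fun i _ => Finset.sum_congr rfl fun j _ => by ring
  rw [h]
  exact integral_nonneg fun z => sq_nonneg _

lemma gaussEnergy_comm (t : ℝ) (α γ : Measure (Space d)) [SFinite α] [SFinite γ] :
    gaussEnergy t α γ = gaussEnergy t γ α := by
  rw [gaussEnergy, gaussEnergy, ← integral_prod_swap]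
  simp_rw [Prod.fst_swap, Prod.snd_swap, norm_sub_rev]

/-- The Gaussian energy of the difference of two measures. -/
noncomputable def gaussDiscrepancy (t : ℝ) (α γ : Measure (Space d)) : ℝ :=
  gaussEnergy t α α - 2 * gaussEnergy t α γ + gaussEnergy t γ γ

/-- Positivity of the quadratic form at α − γ + sτ. Keeping s free replaces Cauchy–Schwarz and gives
a lower bound affine in α, suited to exponentiation into a product. -/
lemma gaussDiscrepancy_ge {t : ℝ} (ht : 0 < t) (α γ τ : Measure (Space d)) [IsFiniteMeasure α]
    [IsFiniteMeasure γ] [IsFiniteMeasure τ] (s : ℝ) :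
    -(2 * s * (gaussEnergy t α τ - gaussEnergy t γ τ) + s ^ 2 * gaussEnergy t τ τ) ≤
      gaussDiscrepancy t α γ := by
  have : ∀ i, IsFiniteMeasure ((![α, γ, τ] : Fin 3 → Measure (Space d)) i) := by
    intro i; fin_cases i <;> assumption
  have h := gaussEnergy_posDef ht ![1, -1, s] ![α, γ, τ]
  simp only [Fin.sum_univ_three, Matrix.cons_val_zero, Matrix.cons_val_one, Matrix.cons_val] at h
  rw [gaussEnergy_comm t γ α, gaussEnergy_comm t τ α, gaussEnergy_comm t τ γ] at h
  unfold gaussDiscrepancy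
  linarith

lemma gaussDiscrepancy_nonneg {t : ℝ} (ht : 0 < t) (α γ : Measure (Space d)) [IsFiniteMeasure α]
    [IsFiniteMeasure γ] : 0 ≤ gaussDiscrepancy t α γ := by
  simpa using gaussDiscrepancy_ge ht α γ 0 0

lemma sq_norm_mul_exp_le {t : ℝ} (ht : 0 < t) (z : Space d) :
    ‖z‖ ^ 2 * exp (-t * ‖z‖ ^ 2) ≤ 2 / t * exp (-(t / 2) * ‖z‖ ^ 2) := by
  have h := add_one_le_exp (t / 2 * ‖z‖ ^ 2)
  have h2 : ‖z‖ ^ 2 ≤ 2 / t * exp (t / 2 * ‖z‖ ^ 2) := by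
    rw [div_mul_eq_mul_div, le_div_iff₀ ht]; linarith
  calc ‖z‖ ^ 2 * exp (-t * ‖z‖ ^ 2)
      ≤ 2 / t * exp (t / 2 * ‖z‖ ^ 2) * exp (-t * ‖z‖ ^ 2) := by gcongr
    _ = _ := by rw [mul_assoc, ← exp_add]; ring_nf

/-- Gaussian convolutions approximate Lipschitz functions uniformly. -/
lemma exists_gauss_conv_close {f : Space d → ℝ} {L : NNReal} (hf : LipschitzWith L f)
    (hfi : Integrable f) {η : ℝ} (hη : 0 < η) :
    ∃ a : ℝ, 1 ≤ a ∧ ∀ t, a ≤ t → ∀ x,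
      |(∫ y, f y * exp (-t * ‖x - y‖ ^ 2)) - gaussMass d t * f x| ≤ η * gaussMass d t := by
  -- The Lipschitz bound L|x − y| is split by the arithmetic-geometric inequality into η/2 plus a
  -- quadratic term, which integrates to at most η/2 of the mass once t exceeds this value.
  refine ⟨max 1 (2 * L ^ 2 * 2 ^ ((d : ℝ) / 2) / η ^ 2), le_max_left _ _, fun t hta x => ?_⟩
  have ht1 : 1 ≤ t := (le_max_left _ _).trans hta
  have ht : 0 < t := by linarith
  have hta' : 2 * L ^ 2 * 2 ^ ((d : ℝ) / 2) / η ^ 2 ≤ t := (le_max_right _ _).trans hta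
  have hk : Integrable (fun y : Space d => exp (-t * ‖x - y‖ ^ 2)) :=
    (integrable_exp_neg_mul_sq_norm ht).comp_sub_left x
  have hk2 : Integrable (fun y : Space d => exp (-(t / 2) * ‖x - y‖ ^ 2)) :=
    (integrable_exp_neg_mul_sq_norm (half_pos ht)).comp_sub_left x
  have hmass : ∫ y : Space d, exp (-t * ‖x - y‖ ^ 2) = gaussMass d t :=
    integral_sub_left_eq_self (fun y : Space d => exp (-t * ‖y‖ ^ 2)) volume x
  have hmass2 : ∫ y : Space d, exp (-(t / 2) * ‖x - y‖ ^ 2) = gaussMass d t * 2 ^ ((d : ℝ) / 2) := by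
    rw [integral_sub_left_eq_self (fun y : Space d => exp (-(t / 2) * ‖y‖ ^ 2)) volume x]
    change gaussMass d (t / 2) = _
    rw [gaussMass_eq ht, gaussMass_eq (half_pos ht), ← mul_rpow (by positivity) (by positivity)]
    congr 1; field_simp
  have hfk : Integrable (fun y => f y * exp (-t * ‖x - y‖ ^ 2)) := by
    refine hfi.mono (hf.continuous.aestronglyMeasurable.mul (by fun_prop))
      (Eventually.of_forall fun y => ?_)
    rw [norm_mul, norm_of_nonneg (exp_pos _).le]
    exact mul_le_of_le_one_right (norm_nonneg _) (exp_neg_mul_sq_le_one ht.le _)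
  have hm := gaussMass_pos (d := d) ht
  calc |(∫ y, f y * exp (-t * ‖x - y‖ ^ 2)) - gaussMass d t * f x|
      = |∫ y, (f y - f x) * exp (-t * ‖x - y‖ ^ 2)| := by
        simp_rw [sub_mul]
        rw [integral_sub hfk (hk.const_mul _), integral_const_mul, hmass, mul_comm (f x)]
    _ ≤ ∫ y, |(f y - f x) * exp (-t * ‖x - y‖ ^ 2)| := abs_integral_le_integral_abs
    _ ≤ ∫ y, (η / 2 * exp (-t * ‖x - y‖ ^ 2) +
          L ^ 2 / (η * t) * exp (-(t / 2) * ‖x - y‖ ^ 2)) := by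
        refine integral_mono ?_ ((hk.const_mul _).add (hk2.const_mul _)) fun y => ?_
        · simp_rw [sub_mul]
          exact (hfk.sub (hk.const_mul _)).abs
        · simp only
          rw [abs_mul, abs_of_pos (exp_pos _)]
          have h1 : |f y - f x| ≤ η / 2 + L ^ 2 / (2 * η) * ‖x - y‖ ^ 2 := by
            have h2 : |f y - f x| ≤ L * ‖x - y‖ := by
              have := hf.dist_le_mul y x
              rwa [dist_eq_norm, dist_eq_norm, norm_sub_rev y x] at this
            have h3 : (L : ℝ) * ‖x - y‖ ≤ η / 2 + L ^ 2 / (2 * η) * ‖x - y‖ ^ 2 := by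
              have : 0 ≤ (η - L * ‖x - y‖) ^ 2 / (2 * η) := by positivity
              have h4 : (η - L * ‖x - y‖) ^ 2 / (2 * η) =
                  η / 2 + L ^ 2 / (2 * η) * ‖x - y‖ ^ 2 - L * ‖x - y‖ := by
                field_simp; ring
              linarith
            linarith
          calc |f y - f x| * exp (-t * ‖x - y‖ ^ 2)
              ≤ (η / 2 + L ^ 2 / (2 * η) * ‖x - y‖ ^ 2) * exp (-t * ‖x - y‖ ^ 2) := by gcongr
            _ = η / 2 * exp (-t * ‖x - y‖ ^ 2) +
                L ^ 2 / (2 * η) * (‖x - y‖ ^ 2 * exp (-t * ‖x - y‖ ^ 2)) := by ring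
            _ ≤ η / 2 * exp (-t * ‖x - y‖ ^ 2) +
                L ^ 2 / (2 * η) * (2 / t * exp (-(t / 2) * ‖x - y‖ ^ 2)) := by
                  exact add_le_add le_rfl (mul_le_mul_of_nonneg_left (sq_norm_mul_exp_le ht _)
                    (by positivity))
            _ = _ := by field_simp
    _ = η / 2 * gaussMass d t + L ^ 2 / (η * t) * (gaussMass d t * 2 ^ ((d : ℝ) / 2)) := by
        rw [integral_add (hk.const_mul _) (hk2.const_mul _), integral_const_mul,
          integral_const_mul, hmass, hmass2]
    _ ≤ η * gaussMass d t := by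
        have h5 : L ^ 2 / (η * t) * 2 ^ ((d : ℝ) / 2) ≤ η / 2 := by
          rw [div_le_iff₀ (by positivity)] at hta'
          rw [div_mul_eq_mul_div, div_le_iff₀ (by positivity)]
          nlinarith
        nlinarith [mul_le_mul_of_nonneg_right h5 hm.le]

/-! ### Energies for the truncated kernel. -/

/-- The mutual energy of two measures for the truncated kernel. -/
noncomputable def truncEnergy (T : ℝ) (α γ : Measure (Space d)) : ℝ :=
  ∫ p, truncKernel d T (p.1 - p.2) ∂(α.prod γ)

/-- The energy of the difference of two measures for the truncated kernel. -/
noncomputable def truncDiscrepancy (T : ℝ) (α γ : Measure (Space d)) : ℝ :=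
  truncEnergy T α α - 2 * truncEnergy T α γ + truncEnergy T γ γ

lemma integrable_growth_sub {α γ : Measure (Space d)} [IsFiniteMeasure α] [IsFiniteMeasure γ]
    (hα : Integrable (growth d) α) (hγ : Integrable (growth d) γ) :
    Integrable (fun p : Space d × Space d => growth d (p.1 - p.2)) (α.prod γ) := by
  refine ((hα.comp_fst γ).add (hγ.comp_snd α)).mono'
    (measurable_growth.comp (measurable_fst.sub measurable_snd)).aestronglyMeasurable
    (Eventually.of_forall fun p => ?_)
  rw [norm_of_nonneg (growth_nonneg _)]
  exact growth_sub_le _ _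

lemma integrable_truncKernel {T : ℝ} (hT : 0 ≤ T) {α γ : Measure (Space d)} [IsFiniteMeasure α]
    [IsFiniteMeasure γ] (hα : Integrable (growth d) α) (hγ : Integrable (growth d) γ) :
    Integrable (fun p : Space d × Space d => truncKernel d T (p.1 - p.2)) (α.prod γ) := by
  obtain ⟨C, -, hC⟩ := exists_integral_abs_mixTerm_le d hT
  refine (((integrable_const (1 : ℝ)).add (integrable_growth_sub hα hγ)).const_mul C).mono'
    ((measurable_truncKernel T).comp (measurable_fst.sub measurable_snd)).aestronglyMeasurable
    (Eventually.of_forall fun p => ?_)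
  exact abs_truncKernel_le (hC _)

lemma measurable_mixTerm_sub :
    Measurable (fun q : (Space d × Space d) × ℝ => mixTerm d (q.1.1 - q.1.2) q.2) :=
  measurable_mixTerm_uncurry.comp
    (show Measurable fun q : (Space d × Space d) × ℝ => (q.1.1 - q.1.2, q.2) by fun_prop)

lemma stronglyMeasurable_integral_norm_mixTerm (T : ℝ) :
    StronglyMeasurable fun p : Space d × Space d => ∫ t in Ioc 0 T, ‖mixTerm d (p.1 - p.2) t‖ :=
  measurable_mixTerm_sub.norm.stronglyMeasurable.integral_prod_right'

lemma integrable_mixTerm_prod {T : ℝ} (hT : 0 ≤ T) {α γ : Measure (Space d)} [IsFiniteMeasure α]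
    [IsFiniteMeasure γ] (hα : Integrable (growth d) α) (hγ : Integrable (growth d) γ) :
    Integrable (fun q : (Space d × Space d) × ℝ => mixTerm d (q.1.1 - q.1.2) q.2)
      ((α.prod γ).prod (volume.restrict (Ioc 0 T))) := by
  obtain ⟨C, -, hC⟩ := exists_integral_abs_mixTerm_le d hT
  have hi : Integrable (fun p : Space d × Space d => C * (1 + growth d (p.1 - p.2))) (α.prod γ) :=
    ((integrable_const (1 : ℝ)).add (integrable_growth_sub hα hγ)).const_mul C
  have hm : AEStronglyMeasurable (fun q : (Space d × Space d) × ℝ => mixTerm d (q.1.1 - q.1.2) q.2)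
      ((α.prod γ).prod (volume.restrict (Ioc 0 T))) :=
    measurable_mixTerm_sub.aestronglyMeasurable
  have h1 : ∀ᵐ p ∂(α.prod γ), Integrable (fun t => mixTerm d (p.1 - p.2) t)
      (volume.restrict (Ioc 0 T)) :=
    Eventually.of_forall fun p => integrableOn_mixTerm (p.1 - p.2) T
  have h2 : Integrable (fun p : Space d × Space d => ∫ t in Ioc 0 T, ‖mixTerm d (p.1 - p.2) t‖)
      (α.prod γ) := by
    refine hi.mono' (stronglyMeasurable_integral_norm_mixTerm T).aestronglyMeasurable
      (Eventually.of_forall fun p => ?_)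
    rw [norm_of_nonneg (integral_nonneg fun _ => norm_nonneg _)]
    exact hC _
  exact (integrable_prod_iff hm).2 ⟨h1, h2⟩

lemma integral_mixTerm_prod {t : ℝ} (ht : 0 ≤ t) (α γ : Measure (Space d)) [IsFiniteMeasure α]
    [IsFiniteMeasure γ] :
    ∫ p : Space d × Space d, mixTerm d (p.1 - p.2) t ∂(α.prod γ) =
      mixWeight d t * (gaussEnergy t α γ -
        (α.real univ * γ.real univ) * if t < 1 then 1 else 0) := by
  unfold mixTerm
  rw [integral_const_mul, integral_sub (integrable_gauss_prod ht α γ) (integrable_const _),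
    integral_const, smul_eq_mul, ← univ_prod_univ, measureReal_prod_prod]
  rfl

lemma integrableOn_mixWeight_mul_gaussEnergy {T : ℝ} (hT : 0 ≤ T) {α γ : Measure (Space d)}
    [IsFiniteMeasure α] [IsFiniteMeasure γ] (hα : Integrable (growth d) α)
    (hγ : Integrable (growth d) γ) :
    IntegrableOn (fun t => mixWeight d t * (gaussEnergy t α γ -
        (α.real univ * γ.real univ) * if t < 1 then 1 else 0)) (Ioc 0 T) := by
  refine (integrable_mixTerm_prod hT hα hγ).integral_prod_right.congr ?_
  filter_upwards [ae_restrict_mem measurableSet_Ioc] with t ht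
  exact integral_mixTerm_prod ht.1.le α γ

lemma truncEnergy_eq {T : ℝ} (hT : 0 ≤ T) {α γ : Measure (Space d)} [IsFiniteMeasure α]
    [IsFiniteMeasure γ] (hα : Integrable (growth d) α) (hγ : Integrable (growth d) γ) :
    truncEnergy T α γ = ∫ t in Ioc 0 T, mixWeight d t * (gaussEnergy t α γ -
        (α.real univ * γ.real univ) * if t < 1 then 1 else 0) := by
  unfold truncEnergy truncKernel
  rw [integral_integral_swap (integrable_mixTerm_prod hT hα hγ)]
  exact setIntegral_congr_fun measurableSet_Ioc fun t ht => integral_mixTerm_prod ht.1.le α γ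

lemma integrableOn_mixWeight {a b : ℝ} (ha : 0 < a) : IntegrableOn (mixWeight d) (Ioc a b) := by
  refine IntegrableOn.mono_set (ContinuousOn.integrableOn_Icc (a := a) (b := b) ?_) Ioc_subset_Icc_self
  refine continuousOn_const.mul (continuousOn_id.rpow_const fun t ht => Or.inl ?_)
  exact (ha.trans_le ht.1).ne'

section Discrepancy

variable {T : ℝ} {α γ : Measure (Space d)}

/-- Neutrality makes the counterterms at t < 1 cancel (1 − 2 + 1 = 0), so the truncated discrepancy
is a genuine mixture of Gaussian ones. -/
lemma mixWeight_mul_gaussDiscrepancy (hαγ : α.real univ = γ.real univ) (t : ℝ) :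
    mixWeight d t * gaussDiscrepancy t α γ =
      mixWeight d t * (gaussEnergy t α α - (α.real univ * α.real univ) * if t < 1 then 1 else 0)
      - 2 * (mixWeight d t *
        (gaussEnergy t α γ - (α.real univ * γ.real univ) * if t < 1 then 1 else 0))
      + mixWeight d t *
        (gaussEnergy t γ γ - (γ.real univ * γ.real univ) * if t < 1 then 1 else 0) := by
  rw [gaussDiscrepancy, hαγ]; ring

variable [IsFiniteMeasure α] [IsFiniteMeasure γ]

lemma integrableOn_mixWeight_mul_gaussDiscrepancy (hT : 0 ≤ T) (hα : Integrable (growth d) α)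
    (hγ : Integrable (growth d) γ) (hαγ : α.real univ = γ.real univ) :
    IntegrableOn (fun t => mixWeight d t * gaussDiscrepancy t α γ) (Ioc 0 T) := by
  simp_rw [mixWeight_mul_gaussDiscrepancy hαγ]
  exact ((integrableOn_mixWeight_mul_gaussEnergy hT hα hα).sub
    ((integrableOn_mixWeight_mul_gaussEnergy hT hα hγ).const_mul 2)).add
    (integrableOn_mixWeight_mul_gaussEnergy hT hγ hγ)

lemma truncDiscrepancy_eq (hT : 0 ≤ T) (hα : Integrable (growth d) α)
    (hγ : Integrable (growth d) γ) (hαγ : α.real univ = γ.real univ) :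
    truncDiscrepancy T α γ = ∫ t in Ioc 0 T, mixWeight d t * gaussDiscrepancy t α γ := by
  simp_rw [mixWeight_mul_gaussDiscrepancy hαγ]
  rw [integral_add, integral_sub, integral_const_mul, truncDiscrepancy, truncEnergy_eq hT hα hα,
    truncEnergy_eq hT hα hγ, truncEnergy_eq hT hγ hγ]
  · exact integrableOn_mixWeight_mul_gaussEnergy hT hα hα
  · exact (integrableOn_mixWeight_mul_gaussEnergy hT hα hγ).const_mul 2
  · exact (integrableOn_mixWeight_mul_gaussEnergy hT hα hα).sub
      ((integrableOn_mixWeight_mul_gaussEnergy hT hα hγ).const_mul 2)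
  · exact integrableOn_mixWeight_mul_gaussEnergy hT hγ hγ

/-- Every scale contributes nonnegatively, so all but a chosen band of scales may be dropped. -/
lemma truncDiscrepancy_ge (hα : Integrable (growth d) α) (hγ : Integrable (growth d) γ)
    (hαγ : α.real univ = γ.real univ) {a b B : ℝ} (ha : 0 < a) (hab : a ≤ b) (hbT : b ≤ T)
    (hB : ∀ t ∈ Ioc a b, B ≤ gaussDiscrepancy t α γ) :
    (∫ t in Ioc a b, mixWeight d t) * B ≤ truncDiscrepancy T α γ := by
  have hT : 0 ≤ T := by linarith
  have hint := integrableOn_mixWeight_mul_gaussDiscrepancy hT hα hγ hαγ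
  have hsub : Ioc a b ⊆ Ioc 0 T := Ioc_subset_Ioc ha.le hbT
  rw [truncDiscrepancy_eq hT hα hγ hαγ, ← integral_mul_const]
  calc ∫ t in Ioc a b, mixWeight d t * B
      ≤ ∫ t in Ioc a b, mixWeight d t * gaussDiscrepancy t α γ := by
        refine setIntegral_mono_on ((integrableOn_mixWeight ha).mul_const B) (hint.mono_set hsub)
          measurableSet_Ioc fun t ht => ?_
        exact mul_le_mul_of_nonneg_left (hB t ht) (mixWeight_nonneg (ha.trans ht.1).le)
    _ ≤ _ := by
        refine setIntegral_mono_set hint ?_ hsub.eventuallyLE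
        filter_upwards [ae_restrict_mem measurableSet_Ioc] with t ht
        exact mul_nonneg (mixWeight_nonneg ht.1.le) (gaussDiscrepancy_nonneg ht.1 α γ)

end Discrepancy

lemma gaussEnergy_withDensity {t : ℝ} (ht : 0 < t) (α : Measure (Space d)) [IsFiniteMeasure α]
    {f : Space d → ℝ} (hf0 : ∀ x, 0 ≤ f x) (hfm : Measurable f) (hfi : Integrable f) :
    gaussEnergy t α (volume.withDensity fun y => ENNReal.ofReal (f y)) =
      ∫ x, (∫ y, f y * exp (-t * ‖x - y‖ ^ 2)) ∂α := by
  have : IsFiniteMeasure (volume.withDensity fun y => ENNReal.ofReal (f y)) :=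
    isFiniteMeasure_withDensity_ofReal hfi.2
  rw [gaussEnergy, integral_prod _ (integrable_gauss_prod ht.le _ _)]
  refine integral_congr_ae (Eventually.of_forall fun x => ?_)
  simp only
  rw [integral_withDensity_eq_integral_toReal_smul (by fun_prop)
    (Eventually.of_forall fun _ => ENNReal.ofReal_lt_top)]
  simp [ENNReal.toReal_ofReal (hf0 _)]

lemma abs_gaussEnergy_withDensity_sub_le {t η : ℝ} (ht : 0 < t) (α : Measure (Space d))
    [IsFiniteMeasure α] {f : Space d → ℝ} (hf0 : ∀ x, 0 ≤ f x) (hfm : Measurable f)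
    (hfi : Integrable f) (hfα : Integrable f α)
    (hclose : ∀ x, |(∫ y, f y * exp (-t * ‖x - y‖ ^ 2)) - gaussMass d t * f x| ≤
      η * gaussMass d t) :
    |gaussEnergy t α (volume.withDensity fun y => ENNReal.ofReal (f y)) -
      gaussMass d t * ∫ x, f x ∂α| ≤ η * gaussMass d t * α.real univ := by
  have : IsFiniteMeasure (volume.withDensity fun y => ENNReal.ofReal (f y)) :=
    isFiniteMeasure_withDensity_ofReal hfi.2
  have hint : Integrable (fun x => ∫ y, f y * exp (-t * ‖x - y‖ ^ 2)) α := by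
    refine (integrable_gauss_prod ht.le α
      (volume.withDensity fun y => ENNReal.ofReal (f y))).integral_prod_left.congr
      (Eventually.of_forall fun x => ?_)
    simp only
    rw [integral_withDensity_eq_integral_toReal_smul (by fun_prop)
      (Eventually.of_forall fun _ => ENNReal.ofReal_lt_top)]
    simp [ENNReal.toReal_ofReal (hf0 _)]
  rw [gaussEnergy_withDensity ht α hf0 hfm hfi, ← integral_const_mul,
    ← integral_sub hint (hfα.const_mul _)]
  exact norm_integral_le_of_norm_le_const (μ := α) (C := η * gaussMass d t)
    (f := fun x => (∫ y, f y * exp (-t * ‖x - y‖ ^ 2)) - gaussMass d t * f x)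
    (Eventually.of_forall hclose)

/-- The truncated energy of a neutral difference of measures controls the difference of their
integrals against a Lipschitz test function. -/
lemma exists_truncDiscrepancy_ge {f : Space d → ℝ} {L : NNReal} (hfL : LipschitzWith L f)
    (hf0 : ∀ x, 0 ≤ f x) (hf1 : ∀ x, f x ≤ 1) (hfi : Integrable f) {η : ℝ} (hη : 0 < η) :
    ∃ W C T₀ : ℝ, 0 < W ∧ 1 ≤ T₀ ∧ ∀ T, T₀ ≤ T → ∀ (α γ : Measure (Space d)) [IsFiniteMeasure α]
      [IsFiniteMeasure γ], Integrable (growth d) α → Integrable (growth d) γ →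
      α.real univ = γ.real univ → ∀ s : ℝ, 0 ≤ s →
      -(W * (2 * s * ((∫ x, f x ∂α) - ∫ x, f x ∂γ) + 4 * s * η * α.real univ + s ^ 2 * C)) ≤
        truncDiscrepancy T α γ := by
  obtain ⟨a, ha1, ha⟩ := exists_gauss_conv_close hfL hfi hη
  have ha0 : 0 < a := by linarith
  set τ : Measure (Space d) := volume.withDensity fun y => ENNReal.ofReal (f y) with hτ
  have : IsFiniteMeasure τ := isFiniteMeasure_withDensity_ofReal hfi.2
  have hfm : Measurable f := hfL.continuous.measurable
  have hbd : ∀ (α : Measure (Space d)) [IsFiniteMeasure α], Integrable f α := fun α _ =>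
    (integrable_const (1 : ℝ)).mono' hfm.aestronglyMeasurable (Eventually.of_forall fun x => by
      rw [norm_of_nonneg (hf0 x)]; exact hf1 x)
  -- One fixed band of scales (a, a + 1] is enough, so the constants do not change as T grows: W is
  -- its weight, and C bounds the normalized self-energy of τ on it.
  refine ⟨∫ t in Ioc a (a + 1), mixWeight d t, (τ.real univ / gaussMass d (a + 1)) ^ 2, a + 1, ?_,
    by linarith, ?_⟩
  · rw [← intervalIntegral.integral_of_le (by linarith)]
    refine intervalIntegral.intervalIntegral_pos_of_pos_on ?_
      (fun t ht => mixWeight_pos (ha0.trans ht.1)) (by linarith)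
    rw [intervalIntegrable_iff_integrableOn_Ioc_of_le (by linarith)]
    exact integrableOn_mixWeight ha0
  · intro T hT α γ _ _ hα hγ hαγ s hs
    rw [← mul_neg]
    refine truncDiscrepancy_ge hα hγ hαγ ha0 (by linarith) hT fun t ht => ?_
    have ht0 : 0 < t := ha0.trans ht.1
    have hm := gaussMass_pos (d := d) ht0
    have hm1 := gaussMass_pos (d := d) (by linarith : 0 < a + 1)
    have hanti := gaussMass_anti (d := d) ht0 ht.2
    -- Dividing by the Gaussian mass makes the potential of τ approximate f itself, within η.
    refine le_trans ?_ (gaussDiscrepancy_ge ht0 α γ τ (s / gaussMass d t))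
    have h1 := abs_le.1 (abs_gaussEnergy_withDensity_sub_le ht0 α hf0 hfm hfi (hbd α)
      (ha t ht.1.le))
    have h2 := abs_le.1 (abs_gaussEnergy_withDensity_sub_le ht0 γ hf0 hfm hfi (hbd γ)
      (ha t ht.1.le))
    rw [← hτ] at h1 h2
    rw [← hαγ] at h2
    have h3 : gaussEnergy t α τ - gaussEnergy t γ τ ≤
        gaussMass d t * ((∫ x, f x ∂α) - (∫ x, f x ∂γ) + 2 * η * α.real univ) := by
      linarith [h1.2, h2.1]
    have h4 : 2 * (s / gaussMass d t) * (gaussEnergy t α τ - gaussEnergy t γ τ) ≤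
        2 * s * ((∫ x, f x ∂α) - (∫ x, f x ∂γ)) + 4 * s * η * α.real univ := by
      calc _ ≤ 2 * (s / gaussMass d t) *
            (gaussMass d t * ((∫ x, f x ∂α) - (∫ x, f x ∂γ) + 2 * η * α.real univ)) := by gcongr
        _ = _ := by field_simp; ring
    have h5 : (s / gaussMass d t) ^ 2 * gaussEnergy t τ τ ≤
        s ^ 2 * (τ.real univ / gaussMass d (a + 1)) ^ 2 := by
      have h6 : s / gaussMass d t ≤ s / gaussMass d (a + 1) := by gcongr
      calc (s / gaussMass d t) ^ 2 * gaussEnergy t τ τ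
          ≤ (s / gaussMass d (a + 1)) ^ 2 * (τ.real univ * τ.real univ) := by
            gcongr
            · exact gaussEnergy_nonneg t τ τ
            · exact gaussEnergy_le ht0.le τ τ
        _ = _ := by ring
    linarith

/-! ### Potentials of measures with bounded density. -/

/-- The potential generated by a measure. -/
noncomputable def potential (μ : Measure (Space d)) (x : Space d) : ℝ := ∫ y, kernel d (x - y) ∂μ

/-- The self-interaction of a measure. -/
noncomputable def selfEnergy (μ : Measure (Space d)) : ℝ :=
  ∫ p : Space d × Space d, kernel d (p.1 - p.2) ∂(μ.prod μ)

lemma HasBoundedDensity.exists_le {μ : Measure (Space d)} (hμ : HasBoundedDensity μ) :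
    ∃ K : ℝ, 0 ≤ K ∧ μ ≤ ENNReal.ofReal K • volume := by
  obtain ⟨ρ, hρ, -, rfl⟩ := hμ
  refine ⟨(eLpNorm ρ ⊤ volume).toReal, ENNReal.toReal_nonneg, ?_⟩
  rw [← withDensity_const]
  refine withDensity_mono ?_
  filter_upwards [ae_le_eLpNormEssSup (f := ρ) (μ := volume)] with x hx
  rw [← eLpNorm_exponent_top] at hx
  rw [ENNReal.ofReal_toReal hρ.2.ne]
  exact (Real.ofReal_le_enorm _).trans hx

lemma absolutelyContinuous_of_le {K : ℝ} {μ : Measure (Space d)}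
    (hK : μ ≤ ENNReal.ofReal K • volume) : μ ≪ volume :=
  (Measure.absolutelyContinuous_of_le hK).trans Measure.smul_absolutelyContinuous

lemma nullSingletonClass_volume (hd : 1 ≤ d) : NullSingletonClass (volume : Measure (Space d)) := by
  have : Nonempty (Fin d) := ⟨⟨0, by omega⟩⟩
  infer_instance

lemma ae_fst_ne_snd (hd : 1 ≤ d) {K : ℝ} (ν μ : Measure (Space d)) [IsFiniteMeasure ν]
    [IsFiniteMeasure μ] (hK : μ ≤ ENNReal.ofReal K • volume) :
    ∀ᵐ p ∂(ν.prod μ), p.1 - p.2 ≠ 0 := by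
  have := nullSingletonClass_volume hd
  have hs : MeasurableSet {p : Space d × Space d | p.1 - p.2 = 0} :=
    (measurable_fst.sub measurable_snd) (measurableSet_singleton 0)
  have h0 : ν.prod μ {p : Space d × Space d | p.1 - p.2 = 0} = 0 := by
    rw [Measure.measure_prod_null hs]
    refine Eventually.of_forall fun x => ?_
    have : Prod.mk x ⁻¹' {p : Space d × Space d | p.1 - p.2 = 0} = {x} := by
      ext y; simp [sub_eq_zero, eq_comm]
    simp only [this, Pi.zero_apply]
    exact absolutelyContinuous_of_le hK (measure_singleton x)
  exact compl_mem_ae_iff.2 h0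

lemma ae_sub_ne_zero (hd : 1 ≤ d) {K : ℝ} (μ : Measure (Space d))
    (hK : μ ≤ ENNReal.ofReal K • volume) (x : Space d) : ∀ᵐ y ∂μ, x - y ≠ 0 := by
  have := nullSingletonClass_volume hd
  have h0 : μ {x} = 0 := absolutelyContinuous_of_le hK (measure_singleton x)
  filter_upwards [compl_mem_ae_iff.2 h0] with y hy h
  exact hy (sub_eq_zero.1 h).symm

section Tail

variable {K M T : ℝ} {μ : Measure (Space d)}

/-- The place where the bounded density acts: the tail potential is bounded, uniformly in x, by the
density bound times the L¹ norm of the tail. -/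
lemma lintegral_tailKernel_sub_le (hK : μ ≤ ENNReal.ofReal K • volume)
    (hM : ∫⁻ x : Space d, ENNReal.ofReal (tailKernel d T x) ≤ ENNReal.ofReal M) (x : Space d) :
    ∫⁻ y, ENNReal.ofReal (tailKernel d T (x - y)) ∂μ ≤ ENNReal.ofReal K * ENNReal.ofReal M := by
  calc ∫⁻ y, ENNReal.ofReal (tailKernel d T (x - y)) ∂μ
      ≤ ∫⁻ y, ENNReal.ofReal (tailKernel d T (x - y)) ∂(ENNReal.ofReal K • volume) :=
        lintegral_mono' hK le_rfl
    _ = ENNReal.ofReal K * ∫⁻ y, ENNReal.ofReal (tailKernel d T (x - y)) := by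
        rw [lintegral_smul_measure, smul_eq_mul]
    _ ≤ _ := by
        rw [lintegral_sub_left_eq_self (fun y => ENNReal.ofReal (tailKernel d T y))]
        gcongr

lemma integrable_tailKernel_sub (hT : 0 ≤ T) (hK : μ ≤ ENNReal.ofReal K • volume)
    (hM : ∫⁻ x : Space d, ENNReal.ofReal (tailKernel d T x) ≤ ENNReal.ofReal M) (x : Space d) :
    Integrable (fun y => tailKernel d T (x - y)) μ := by
  refine ⟨((measurable_tailKernel T).comp (measurable_const.sub measurable_id)).aestronglyMeasurable,
    ?_⟩
  rw [hasFiniteIntegral_iff_ofReal (Eventually.of_forall fun y => tailKernel_nonneg hT _)]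
  exact (lintegral_tailKernel_sub_le hK hM x).trans_lt
    (ENNReal.mul_lt_top ENNReal.ofReal_lt_top ENNReal.ofReal_lt_top)

lemma integral_tailKernel_sub_le (hT : 0 ≤ T) (hK0 : 0 ≤ K) (hM0 : 0 ≤ M)
    (hK : μ ≤ ENNReal.ofReal K • volume)
    (hM : ∫⁻ x : Space d, ENNReal.ofReal (tailKernel d T x) ≤ ENNReal.ofReal M) (x : Space d) :
    ∫ y, tailKernel d T (x - y) ∂μ ≤ K * M := by
  rw [integral_eq_lintegral_of_nonneg_ae (Eventually.of_forall fun y => tailKernel_nonneg hT _)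
    (integrable_tailKernel_sub hT hK hM x).1]
  refine ENNReal.toReal_le_of_le_ofReal (mul_nonneg hK0 hM0) ?_
  rw [ENNReal.ofReal_mul hK0]
  exact lintegral_tailKernel_sub_le hK hM x

lemma integrable_tailKernel_prod (hT : 0 ≤ T) (ν : Measure (Space d)) [IsFiniteMeasure ν]
    [IsFiniteMeasure μ] (hK : μ ≤ ENNReal.ofReal K • volume)
    (hM : ∫⁻ x : Space d, ENNReal.ofReal (tailKernel d T x) ≤ ENNReal.ofReal M) :
    Integrable (fun p : Space d × Space d => tailKernel d T (p.1 - p.2)) (ν.prod μ) := by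
  have hm : Measurable fun p : Space d × Space d => tailKernel d T (p.1 - p.2) :=
    (measurable_tailKernel T).comp (measurable_fst.sub measurable_snd)
  refine ⟨hm.aestronglyMeasurable, ?_⟩
  rw [hasFiniteIntegral_iff_ofReal (Eventually.of_forall fun y => tailKernel_nonneg hT _),
    lintegral_prod _ hm.ennreal_ofReal.aemeasurable]
  calc ∫⁻ x, ∫⁻ y, ENNReal.ofReal (tailKernel d T (x - y)) ∂μ ∂ν
      ≤ ∫⁻ _x, ENNReal.ofReal K * ENNReal.ofReal M ∂ν :=
        lintegral_mono fun x => lintegral_tailKernel_sub_le hK hM x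
    _ < ⊤ := by
        rw [lintegral_const]
        exact ENNReal.mul_lt_top (ENNReal.mul_lt_top ENNReal.ofReal_lt_top ENNReal.ofReal_lt_top)
          (measure_lt_top _ _)

end Tail

lemma integrable_truncKernel_sub {T : ℝ} (hT : 0 ≤ T) {μ : Measure (Space d)} [IsFiniteMeasure μ]
    (hg : Integrable (growth d) μ) (x : Space d) :
    Integrable (fun y => truncKernel d T (x - y)) μ := by
  obtain ⟨C, -, hC⟩ := exists_integral_abs_mixTerm_le d hT
  refine (((integrable_const (1 + growth d x)).add hg).const_mul C).mono'
    ((measurable_truncKernel T).comp (measurable_const.sub measurable_id)).aestronglyMeasurable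
    (Eventually.of_forall fun y => ?_)
  have hC0 : 0 ≤ C := by
    have h := (abs_nonneg _).trans (abs_truncKernel_le (hC x))
    exact nonneg_of_mul_nonneg_left h (by linarith [growth_nonneg x])
  refine (abs_truncKernel_le (hC _)).trans (mul_le_mul_of_nonneg_left ?_ hC0)
  have := growth_sub_le x y
  simp only [Pi.add_apply]
  linarith

lemma integrable_kernel_sub (hd : 1 ≤ d) {K : ℝ} {μ : Measure (Space d)} [IsFiniteMeasure μ]
    (hK : μ ≤ ENNReal.ofReal K • volume) (hg : Integrable (growth d) μ) (x : Space d) :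
    Integrable (fun y => kernel d (x - y)) μ := by
  obtain ⟨κ, hκ⟩ := exists_kernel_eq hd
  obtain ⟨C, -, hC⟩ := exists_lintegral_tailKernel_le hd
  refine (((integrable_const κ).add (integrable_truncKernel_sub zero_le_one hg x)).add
    (integrable_tailKernel_sub zero_le_one hK (hC 1 le_rfl) x)).congr ?_
  filter_upwards [ae_sub_ne_zero hd μ hK x] with y hy
  exact (hκ 1 le_rfl _ hy).symm

lemma integrable_kernel_prod (hd : 1 ≤ d) {K : ℝ} {ν μ : Measure (Space d)} [IsFiniteMeasure ν]
    [IsFiniteMeasure μ] (hK : μ ≤ ENNReal.ofReal K • volume) (hν : Integrable (growth d) ν)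
    (hμ : Integrable (growth d) μ) :
    Integrable (fun p : Space d × Space d => kernel d (p.1 - p.2)) (ν.prod μ) := by
  obtain ⟨κ, hκ⟩ := exists_kernel_eq hd
  obtain ⟨C, -, hC⟩ := exists_lintegral_tailKernel_le hd
  refine (((integrable_const κ).add (integrable_truncKernel zero_le_one hν hμ)).add
    (integrable_tailKernel_prod zero_le_one ν hK (hC 1 le_rfl))).congr ?_
  filter_upwards [ae_fst_ne_snd hd ν μ hK] with p hp
  exact (hκ 1 le_rfl _ hp).symm

/-- A measure of finite energy has the moment corresponding to the growth of the kernel. -/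
lemma integrable_growth_of_integrable_kernel {μ : Measure (Space d)} [IsProbabilityMeasure μ]
    (h : Integrable (fun p : Space d × Space d => kernel d (p.1 - p.2)) (μ.prod μ)) :
    Integrable (growth d) μ := by
  by_cases h2 : d ≤ 2
  -- One center x with integrable section suffices: 1 + r is at most 2 for r ≤ 1 and at most 2r for
  -- r ≥ 1, so log(1 + r) ≤ log 2 + |log r| at r = |x − y|.
  · obtain ⟨x, hx⟩ := h.prod_right_ae.exists
    refine ((integrable_const (log 2 + growth d x)).add hx.abs).mono'
      measurable_growth.aestronglyMeasurable (Eventually.of_forall fun y => ?_)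
    rw [norm_of_nonneg (growth_nonneg _)]
    have h1 : growth d y ≤ growth d x + growth d (x - y) := by
      have := growth_sub_le x (x - y); rwa [sub_sub_cancel] at this
    have h3 : growth d (x - y) ≤ log 2 + |kernel d (x - y)| := by
      simp only [growth, kernel, h2, if_true, abs_neg]
      set r := ‖x - y‖ with hr
      have hr0 : 0 ≤ r := norm_nonneg _
      rcases le_total r 1 with hr1 | hr1
      · have : log (1 + r) ≤ log 2 := log_le_log (by linarith) (by linarith)
        linarith [abs_nonneg (log r)]
      · have : log (1 + r) ≤ log (2 * r) := log_le_log (by linarith) (by linarith)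
        rw [log_mul two_ne_zero (by linarith)] at this
        linarith [le_abs_self (log r)]
    simp only [Pi.add_apply]
    linarith
  · have : growth d = fun _ => 0 := by funext x; simp [growth, h2]
    rw [this]; exact integrable_zero _ _ _

/-! ### Point configurations and the lower bound by smearing. -/

/-- The empirical measure of a configuration, with total mass the number of points. -/
noncomputable def pointMeasure {N : ℕ} (X : Fin N → Space d) : Measure (Space d) :=
  Measure.sum fun i => Measure.dirac (X i)

section PointMeasure

variable {N : ℕ} (X : Fin N → Space d)

lemma pointMeasure_eq : pointMeasure X = ∑ i, Measure.dirac (X i) := Measure.sum_fintype _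

instance : IsFiniteMeasure (pointMeasure X) := by
  rw [pointMeasure_eq]; infer_instance

lemma pointMeasure_real_univ : (pointMeasure X).real univ = N := by
  rw [pointMeasure_eq, measureReal_def]
  simp

lemma integrable_pointMeasure {f : Space d → ℝ} (hf : Measurable f) :
    Integrable f (pointMeasure X) := by
  rw [pointMeasure_eq]
  refine integrable_finsetSum_measure.2 fun i _ => ?_
  exact (integrable_const (f (X i))).congr ((ae_dirac_iff
    (measurableSet_eq_fun measurable_const hf)).2 rfl)

lemma integral_pointMeasure {f : Space d → ℝ} (hf : Measurable f) :
    ∫ x, f x ∂(pointMeasure X) = ∑ i, f (X i) := by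
  have h := integrable_pointMeasure X hf
  rw [pointMeasure_eq] at h ⊢
  rw [integral_finsetSum_measure fun i _ => (integrable_finsetSum_measure.1 h) i (Finset.mem_univ i)]
  exact Finset.sum_congr rfl fun i _ => integral_dirac _ _

lemma truncEnergy_pointMeasure_left {T : ℝ} (hT : 0 ≤ T) {γ : Measure (Space d)}
    [IsFiniteMeasure γ] (hγ : Integrable (growth d) γ) :
    truncEnergy T (pointMeasure X) γ = ∑ i, ∫ y, truncKernel d T (X i - y) ∂γ := by
  rw [truncEnergy, integral_prod _ (integrable_truncKernel hT
    (integrable_pointMeasure X measurable_growth) hγ)]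
  exact integral_pointMeasure X (StronglyMeasurable.integral_prod_right'
    (f := fun p : Space d × Space d => truncKernel d T (p.1 - p.2))
    ((measurable_truncKernel T).comp (measurable_fst.sub measurable_snd)).stronglyMeasurable).measurable

lemma truncEnergy_pointMeasure {T : ℝ} (hT : 0 ≤ T) :
    truncEnergy T (pointMeasure X) (pointMeasure X) = ∑ i, ∑ j, truncKernel d T (X i - X j) := by
  rw [truncEnergy_pointMeasure_left X hT (integrable_pointMeasure X measurable_growth)]
  exact Finset.sum_congr rfl fun i _ => integral_pointMeasure X
    ((measurable_truncKernel T).comp (measurable_const.sub measurable_id))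

end PointMeasure

/-- The next order energy of a configuration is bounded below by the truncated energy of its
discrepancy. -/
lemma nextOrderEnergy_ge (hd : 1 ≤ d) : ∃ κ : ℝ, 0 ≤ κ ∧
    ∀ (μ : Measure (Space d)) [IsProbabilityMeasure μ] (K M T : ℝ), 0 ≤ K → 0 ≤ M → 1 ≤ T →
      μ ≤ ENNReal.ofReal K • volume → Integrable (growth d) μ →
      ∫⁻ x : Space d, ENNReal.ofReal (tailKernel d T x) ≤ ENNReal.ofReal M →
      ∀ (N : ℕ) (X : Fin N → Space d), Function.Injective X →
      truncDiscrepancy T (pointMeasure X) ((N : NNReal) • μ) -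
        (κ * N + N * truncKernel d T 0 + 2 * N ^ 2 * (K * M)) ≤
      (∑ i, ∑ j, if i ≠ j then kernel d (X i - X j) else 0) - 2 * N * ∑ i, potential μ (X i) +
        N ^ 2 * selfEnergy μ := by
  obtain ⟨κ, hκ⟩ := exists_kernel_eq hd
  refine ⟨|κ|, abs_nonneg _, fun μ _ K M T hK0 hM0 hT hK hg hM N X hX => ?_⟩
  have hT0 : 0 ≤ T := by linarith
  -- The tail is nonnegative and dropped off the diagonal; inserting the diagonal costs N(κ +
  -- g_T(0)).
  have hpair : κ * N ^ 2 + truncEnergy T (pointMeasure X) (pointMeasure X) -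
      N * (κ + truncKernel d T 0) ≤ ∑ i, ∑ j, if i ≠ j then kernel d (X i - X j) else 0 := by
    calc κ * N ^ 2 + truncEnergy T (pointMeasure X) (pointMeasure X) - N * (κ + truncKernel d T 0)
        = ∑ i, ∑ j, (κ + truncKernel d T (X i - X j) -
            if i = j then κ + truncKernel d T 0 else 0) := by
          rw [truncEnergy_pointMeasure X hT0]
          simp [Finset.sum_add_distrib, Finset.sum_sub_distrib]
          ring
      _ ≤ _ := by
          refine Finset.sum_le_sum fun i _ => Finset.sum_le_sum fun j _ => ?_
          by_cases hij : i = j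
          · subst hij; simp
          · have hne : X i - X j ≠ 0 := sub_ne_zero.2 (hX.ne hij)
            simp only [hij, if_false, ne_eq, not_false_iff, if_true]
            rw [hκ T hT _ hne]
            linarith [tailKernel_nonneg hT0 (X i - X j)]
  -- The cross term carries a minus sign, so here the tail cannot be dropped and is bounded by K M.
  have hpot : ∀ x, potential μ x ≤ κ + (∫ y, truncKernel d T (x - y) ∂μ) + K * M := by
    intro x
    have h1 := integrable_truncKernel_sub hT0 hg x
    have h2 := integrable_tailKernel_sub hT0 hK hM x
    calc potential μ x = ∫ y, (κ + truncKernel d T (x - y) + tailKernel d T (x - y)) ∂μ := by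
          refine integral_congr_ae ?_
          filter_upwards [ae_sub_ne_zero hd μ hK x] with y hy
          exact hκ T hT _ hy
      _ = κ + (∫ y, truncKernel d T (x - y) ∂μ) + ∫ y, tailKernel d T (x - y) ∂μ := by
          have h3 : Integrable (fun y => κ + truncKernel d T (x - y)) μ := (integrable_const κ).add h1
          rw [integral_add h3 h2, integral_add (integrable_const κ) h1]
          simp
      _ ≤ _ := by linarith [integral_tailKernel_sub_le hT0 hK0 hM0 hK hM x]
  have hself : κ + truncEnergy T μ μ ≤ selfEnergy μ := by
    have h1 := integrable_truncKernel hT0 hg hg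
    calc κ + truncEnergy T μ μ = ∫ p : Space d × Space d, (κ + truncKernel d T (p.1 - p.2))
          ∂(μ.prod μ) := by
          rw [integral_add (integrable_const κ) h1, truncEnergy]; simp
      _ ≤ _ := by
          refine integral_mono_ae ((integrable_const κ).add h1) (integrable_kernel_prod hd hK hg hg) ?_
          filter_upwards [ae_fst_ne_snd hd μ μ hK] with p hp
          rw [hκ T hT _ hp]
          linarith [tailKernel_nonneg hT0 (p.1 - p.2)]
  have hcross : truncEnergy T (pointMeasure X) ((N : NNReal) • μ) =
      N * ∑ i, ∫ y, truncKernel d T (X i - y) ∂μ := by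
    rw [truncEnergy_pointMeasure_left X hT0 hg.smul_measure_nnreal, Finset.mul_sum]
    refine Finset.sum_congr rfl fun i _ => ?_
    rw [integral_smul_nnreal_measure]
    simp [NNReal.smul_def]
  have hμμ : truncEnergy T ((N : NNReal) • μ) ((N : NNReal) • μ) = N ^ 2 * truncEnergy T μ μ := by
    rw [truncEnergy, integral_prod _ (integrable_truncKernel hT0 hg.smul_measure_nnreal
      hg.smul_measure_nnreal), truncEnergy, integral_prod _ (integrable_truncKernel hT0 hg hg)]
    simp_rw [integral_smul_nnreal_measure, NNReal.smul_def, smul_eq_mul, integral_const_mul]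
    simp
    ring
  have hsum : ∑ i, potential μ (X i) ≤
      N * κ + (∑ i, ∫ y, truncKernel d T (X i - y) ∂μ) + N * (K * M) := by
    refine (Finset.sum_le_sum fun i _ => hpot (X i)).trans (le_of_eq ?_)
    simp [Finset.sum_add_distrib]
  rw [truncDiscrepancy, hcross, hμμ]
  have hN : (0 : ℝ) ≤ N := Nat.cast_nonneg N
  have h3 := mul_le_mul_of_nonneg_left hsum (by linarith : (0 : ℝ) ≤ 2 * N)
  have h4 := mul_le_mul_of_nonneg_left hself (by positivity : (0 : ℝ) ≤ (N : ℝ) ^ 2)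
  -- The κ N² contributions cancel by neutrality; only the diagonal −κN survives, and κ has no
  -- definite sign.
  have h5 : N * κ ≤ |κ| * N := by rw [mul_comm]; exact mul_le_mul_of_nonneg_right (le_abs_self κ) hN
  linarith

/-! ### Splitting of the Hamiltonian and Euler–Lagrange conditions. -/

/-- The effective potential of the Euler-Lagrange equation, which vanishes on the support of an
equilibrium measure. -/
noncomputable def effectivePotential (V : Space d → ℝ) (μ : Measure (Space d)) (x : Space d) : ℝ :=
  potential μ x + V x / 2 - (selfEnergy μ + (∫ y, V y ∂μ) / 2)

lemma measurable_potential (μ : Measure (Space d)) [SFinite μ] : Measurable (potential μ) :=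
  (StronglyMeasurable.integral_prod_right'
    (f := fun p : Space d × Space d => kernel d (p.1 - p.2))
    (measurable_kernel.comp (measurable_fst.sub measurable_snd)).stronglyMeasurable).measurable

lemma measurable_effectivePotential {V : Space d → ℝ} (hV : Continuous V) (μ : Measure (Space d))
    [SFinite μ] : Measurable (effectivePotential V μ) :=
  ((measurable_potential μ).add (hV.measurable.div_const 2)).sub_const _

/-- A purely algebraic expansion around Nμ: the part linear in the configuration is gathered in the
effective potential, and the last bracket is the quadratic interaction of the discrepancy without
its diagonal. -/
lemma hamiltonian_eq (V : Space d → ℝ) (μ : Measure (Space d)) (N : ℕ) (X : Fin N → Space d) :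
    hamiltonian V N X = N ^ 2 * energy V μ + 2 * N * ∑ i, effectivePotential V μ (X i) +
      ((∑ i, ∑ j, if i ≠ j then kernel d (X i - X j) else 0) - 2 * N * ∑ i, potential μ (X i) +
        N ^ 2 * selfEnergy μ) := by
  have h : ∑ i, effectivePotential V μ (X i) = ∑ i, potential μ (X i) + (∑ i, V (X i)) / 2 -
      N * (selfEnergy μ + (∫ y, V y ∂μ) / 2) := by
    simp [effectivePotential, Finset.sum_add_distrib, Finset.sum_sub_distrib, Finset.sum_div,
      mul_add]
  rw [h, hamiltonian, energy]
  change _ = N ^ 2 * (selfEnergy μ + _) + _ + _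
  ring

lemma kernel_sub_comm (x y : Space d) : kernel d (x - y) = kernel d (y - x) := by
  simp only [kernel, norm_sub_rev]

lemma integrable_kernel_swap {ν μ : Measure (Space d)} [SFinite ν] [SFinite μ]
    (h : Integrable (fun p : Space d × Space d => kernel d (p.1 - p.2)) (ν.prod μ)) :
    Integrable (fun p : Space d × Space d => kernel d (p.1 - p.2)) (μ.prod ν) :=
  h.swap.congr (Eventually.of_forall fun _ => kernel_sub_comm _ _)

lemma integral_kernel_swap (ν μ : Measure (Space d)) [SFinite ν] [SFinite μ] :
    ∫ p : Space d × Space d, kernel d (p.1 - p.2) ∂(μ.prod ν) =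
      ∫ p : Space d × Space d, kernel d (p.1 - p.2) ∂(ν.prod μ) := by
  rw [← integral_prod_swap]
  exact integral_congr_ae (Eventually.of_forall fun _ => kernel_sub_comm _ _)

section Mixture

variable {V : Space d → ℝ} {μ ν : Measure (Space d)} [IsProbabilityMeasure μ]
  [IsProbabilityMeasure ν]

lemma mixture_prod (a b : NNReal) : (a • μ + b • ν).prod (a • μ + b • ν) =
    (a * a) • μ.prod μ + (a * b) • μ.prod ν + ((b * a) • ν.prod μ + (b * b) • ν.prod ν) := by
  simp only [Measure.add_prod, Measure.prod_add, Measure.prod_smul_left, Measure.prod_smul_right,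
    smul_add, smul_smul]
  rw [mul_comm b a]
  abel

lemma HasFiniteEnergy.mixture (hμ : HasFiniteEnergy V μ) (hν : HasFiniteEnergy V ν)
    (hνμ : Integrable (fun p : Space d × Space d => kernel d (p.1 - p.2)) (ν.prod μ))
    (a b : NNReal) : HasFiniteEnergy V (a • μ + b • ν) where
  noAtoms x := by simp [hμ.noAtoms x, hν.noAtoms x]
  integrable_kernel := by
    rw [mixture_prod]
    exact ((hμ.integrable_kernel.smul_measure_nnreal).add_measure
      (integrable_kernel_swap hνμ).smul_measure_nnreal).add_measure
      (hνμ.smul_measure_nnreal.add_measure hν.integrable_kernel.smul_measure_nnreal)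
  integrable_potential :=
    hμ.integrable_potential.smul_measure_nnreal.add_measure
      hν.integrable_potential.smul_measure_nnreal

lemma energy_mixture (hμ : HasFiniteEnergy V μ) (hν : HasFiniteEnergy V ν)
    (hνμ : Integrable (fun p : Space d × Space d => kernel d (p.1 - p.2)) (ν.prod μ))
    (a b : NNReal) : energy V (a • μ + b • ν) =
      a ^ 2 * selfEnergy μ + 2 * a * b * (∫ p : Space d × Space d, kernel d (p.1 - p.2) ∂(ν.prod μ))
      + b ^ 2 * selfEnergy ν + a * (∫ x, V x ∂μ) + b * (∫ x, V x ∂ν) := by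
  have h1 := (hμ.integrable_kernel).smul_measure_nnreal (c := a * a)
  have h2 := (integrable_kernel_swap hνμ).smul_measure_nnreal (c := a * b)
  have h3 := hνμ.smul_measure_nnreal (c := b * a)
  have h4 := (hν.integrable_kernel).smul_measure_nnreal (c := b * b)
  rw [energy, mixture_prod, integral_add_measure (h1.add_measure h2) (h3.add_measure h4),
    integral_add_measure h1 h2, integral_add_measure h3 h4,
    integral_add_measure hμ.integrable_potential.smul_measure_nnreal
      hν.integrable_potential.smul_measure_nnreal]
  simp only [integral_smul_nnreal_measure, integral_kernel_swap ν μ, NNReal.smul_def, smul_eq_mul, NNReal.coe_mul, selfEnergy]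
  ring

/-- The Euler-Lagrange inequality in weak form. -/
lemma IsEquilibriumMeasure.integral_effectivePotential_nonneg (hμ : IsEquilibriumMeasure V μ)
    (hν : HasFiniteEnergy V ν)
    (hνμ : Integrable (fun p : Space d × Space d => kernel d (p.1 - p.2)) (ν.prod μ)) :
    Integrable (effectivePotential V μ) ν ∧ 0 ≤ ∫ x, effectivePotential V μ x ∂ν := by
  have hpot : Integrable (potential μ) ν := hνμ.integral_prod_left
  refine ⟨(hpot.add (hν.integrable_potential.div_const 2)).sub (integrable_const _), ?_⟩
  have hS : ∫ x, potential μ x ∂ν = ∫ p : Space d × Space d, kernel d (p.1 - p.2) ∂(ν.prod μ) :=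
    (integral_prod _ hνμ).symm
  have hval : ∫ x, effectivePotential V μ x ∂ν =
      (∫ p : Space d × Space d, kernel d (p.1 - p.2) ∂(ν.prod μ)) + (∫ x, V x ∂ν) / 2 -
        (selfEnergy μ + (∫ y, V y ∂μ) / 2) := by
    have h1 : Integrable (fun x => potential μ x + V x / 2) ν :=
      hpot.add (hν.integrable_potential.div_const 2)
    unfold effectivePotential
    rw [integral_sub h1 (integrable_const _),
      integral_add hpot (hν.integrable_potential.div_const 2), hS, integral_div]
    simp
  rw [hval]
  set S := ∫ p : Space d × Space d, kernel d (p.1 - p.2) ∂(ν.prod μ)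
  -- Minimality is tested on (1 − t)μ + tν; the energy is quadratic in t, and its increment is
  -- divided by t.
  have key : ∀ t : ℝ, 0 < t → t < 1 →
      0 ≤ 2 * (S + (∫ x, V x ∂ν) / 2 - (selfEnergy μ + (∫ y, V y ∂μ) / 2)) +
        t * (selfEnergy μ - 2 * S + selfEnergy ν) := by
    intro t ht0 ht1
    have hprob : IsProbabilityMeasure ((1 - t).toNNReal • μ + t.toNNReal • ν) := by
      constructor
      simp only [Measure.add_apply, Measure.smul_apply, measure_univ]
      rw [ENNReal.smul_def, ENNReal.smul_def, smul_eq_mul, smul_eq_mul, mul_one, mul_one,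
        ← ENNReal.ofReal, ← ENNReal.ofReal, ← ENNReal.ofReal_add (by linarith) ht0.le]
      simp
    have h := hμ.energy_le _ hprob (hμ.hasFiniteEnergy.mixture hν hνμ _ _)
    rw [energy_mixture hμ.hasFiniteEnergy hν hνμ, Real.coe_toNNReal _ (by linarith),
      Real.coe_toNNReal _ ht0.le] at h
    change selfEnergy μ + _ ≤ _ at h
    refine nonneg_of_mul_nonneg_right (b := _) (a := t) ?_ ht0
    linarith
  by_contra hneg
  push Not at hneg
  set A := S + (∫ x, V x ∂ν) / 2 - (selfEnergy μ + (∫ y, V y ∂μ) / 2)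
  set B := selfEnergy μ - 2 * S + selfEnergy ν
  have hB : 0 ≤ |B| := abs_nonneg B
  -- If A < 0, this t gives tB ≤ −A, hence 2A + tB ≤ A < 0. When B ≤ 0 any t contradicts, and t =
  -- 1/2 avoids the excluded value 1.
  have hlt : -A / (|B| - A) < 1 ∨ B ≤ 0 := by
    by_cases h : B ≤ 0
    · exact Or.inr h
    · left
      rw [div_lt_one (by linarith), abs_of_pos (not_le.1 h)]
      linarith [not_le.1 h]
  rcases hlt with hlt | hB0
  · have hpos : 0 < -A / (|B| - A) := div_pos (by linarith) (by linarith)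
    have h1 := key _ hpos hlt
    have h2 : -A / (|B| - A) * B ≤ -A := by
      rw [div_mul_eq_mul_div, div_le_iff₀ (by linarith)]
      nlinarith [le_abs_self B]
    linarith
  · have h1 := key (1 / 2) (by norm_num) (by norm_num)
    linarith

end Mixture

/-- The Euler-Lagrange inequality. -/
lemma IsEquilibriumMeasure.ae_effectivePotential_nonneg (hd : 1 ≤ d) {V : Space d → ℝ}
    (hV : Continuous V) {μ : Measure (Space d)} (hμ : IsEquilibriumMeasure V μ) {K : ℝ}
    (hK : μ ≤ ENNReal.ofReal K • volume) : ∀ᵐ x, 0 ≤ effectivePotential V μ x := by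
  have := hμ.isProbabilityMeasure
  have := nullSingletonClass_volume hd
  have hg := integrable_growth_of_integrable_kernel hμ.hasFiniteEnergy.integrable_kernel
  have hmeas := measurable_effectivePotential hV μ
  have hball : ∀ n : ℕ, ∀ᵐ x, x ∈ Metric.closedBall (0 : Space d) n →
      0 ≤ effectivePotential V μ x := by
    intro n
    set B : Set (Space d) := {x | effectivePotential V μ x < 0} ∩ Metric.closedBall 0 n with hB
    have hBm : MeasurableSet B :=
      (hmeas measurableSet_Iio).inter Metric.isClosed_closedBall.measurableSet
    suffices hB0 : volume B = 0 by
      filter_upwards [compl_mem_ae_iff.2 hB0] with x hx hxn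
      by_contra hneg
      exact hx ⟨not_le.1 hneg, hxn⟩
    by_contra hB0
    have hBtop : volume B ≠ ⊤ :=
      ((measure_mono inter_subset_right).trans_lt measure_closedBall_lt_top).ne
    set ν : Measure (Space d) := ProbabilityTheory.cond volume B with hν
    have hνp : IsProbabilityMeasure ν :=
      ProbabilityTheory.cond_isProbabilityMeasure_of_finite hB0 hBtop
    have hνK : ν ≤ ENNReal.ofReal ((volume B)⁻¹).toReal • volume := by
      rw [ENNReal.ofReal_toReal (ENNReal.inv_ne_top.2 hB0)]
      exact smul_mono_right _ Measure.restrict_le_self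
    have hνB : ∀ᵐ x ∂ν, x ∈ B :=
      Measure.ae_smul_measure (ae_restrict_mem hBm) _
    have hνball : ∀ᵐ x ∂ν, x ∈ Metric.closedBall (0 : Space d) n := hνB.mono fun x hx => hx.2
    have hνg : Integrable (growth d) ν := by
      refine (integrable_const (log (1 + n))).mono' measurable_growth.aestronglyMeasurable ?_
      filter_upwards [hνball] with x hx
      rw [norm_of_nonneg (growth_nonneg x)]
      rw [mem_closedBall_zero_iff] at hx
      unfold growth
      split_ifs
      · exact log_le_log (by positivity) (by linarith)
      · exact log_nonneg (by linarith [norm_nonneg x])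
    obtain ⟨b, hb⟩ := (isCompact_closedBall (0 : Space d) n).exists_bound_of_continuousOn
      hV.continuousOn
    have hνV : HasFiniteEnergy V ν :=
      { noAtoms := fun x => absolutelyContinuous_of_le hνK (measure_singleton x)
        integrable_kernel := integrable_kernel_prod hd hνK hνg hνg
        integrable_potential := (integrable_const b).mono' hV.measurable.aestronglyMeasurable
          (hνball.mono hb) }
    obtain ⟨hint, hpos⟩ := hμ.integral_effectivePotential_nonneg hνV
      (integrable_kernel_prod hd hK hνg hg)
    have hle : 0 ≤ᵐ[ν] fun x => -effectivePotential V μ x :=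
      hνB.mono fun x hx => by
        have : effectivePotential V μ x < 0 := hx.1
        simp only [Pi.zero_apply]; linarith
    have hzero : ∫ x, -effectivePotential V μ x ∂ν = 0 := by
      refine le_antisymm ?_ (integral_nonneg_of_ae hle)
      rw [integral_neg]; linarith
    rw [integral_eq_zero_iff_of_nonneg_ae hle hint.neg] at hzero
    obtain ⟨x, hx1, hx2⟩ := (hνB.and hzero).exists
    have h1 : effectivePotential V μ x < 0 := hx1.1
    simp only [Pi.zero_apply] at hx2
    linarith
  filter_upwards [ae_all_iff.2 hball] with x hx
  obtain ⟨n, hn⟩ := exists_nat_ge ‖x‖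
  exact hx n (mem_closedBall_zero_iff.2 hn)

/-- The Euler-Lagrange equation. -/
lemma IsEquilibriumMeasure.ae_effectivePotential_eq_zero (hd : 1 ≤ d) {V : Space d → ℝ}
    (hV : Continuous V) {μ : Measure (Space d)} (hμ : IsEquilibriumMeasure V μ) {K : ℝ}
    (hK : μ ≤ ENNReal.ofReal K • volume) : ∀ᵐ x ∂μ, effectivePotential V μ x = 0 := by
  have := hμ.isProbabilityMeasure
  have hk := hμ.hasFiniteEnergy.integrable_kernel
  have hpot : Integrable (potential μ) μ := hk.integral_prod_left
  have hVi := hμ.hasFiniteEnergy.integrable_potential.div_const 2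
  have h1 : Integrable (fun x => potential μ x + V x / 2) μ := hpot.add hVi
  have hint : Integrable (effectivePotential V μ) μ := h1.sub (integrable_const _)
  -- The constant in ζ is its μ-mean before subtraction; a nonnegative function of mean zero
  -- vanishes almost everywhere.
  have hzero : ∫ x, effectivePotential V μ x ∂μ = 0 := by
    have hS : ∫ x, potential μ x ∂μ = selfEnergy μ := (integral_prod _ hk).symm
    unfold effectivePotential
    rw [integral_sub h1 (integrable_const _), integral_add hpot hVi, hS, integral_div]
    simp
  exact (integral_eq_zero_iff_of_nonneg_ae ((absolutelyContinuous_of_le hK).ae_le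
    (hμ.ae_effectivePotential_nonneg hd hV hK)) hint).1 hzero

/-- Transfers exponential integrability from V to ζ: the potential of μ decreases at most like the
growth of the kernel. -/
lemma effectivePotential_ge (hd : 1 ≤ d) {K : ℝ} (V : Space d → ℝ) {μ : Measure (Space d)}
    [IsProbabilityMeasure μ] (hK : μ ≤ ENNReal.ofReal K • volume) (hg : Integrable (growth d) μ) :
    ∃ c : ℝ, ∀ x, V x / 2 - growth d x - c ≤ effectivePotential V μ x := by
  refine ⟨(∫ y, growth d y ∂μ) + (selfEnergy μ + (∫ y, V y ∂μ) / 2), fun x => ?_⟩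
  have h : -(growth d x + ∫ y, growth d y ∂μ) ≤ potential μ x := by
    calc -(growth d x + ∫ y, growth d y ∂μ) = ∫ y, -(growth d x + growth d y) ∂μ := by
          rw [integral_neg, integral_add (integrable_const _) hg]; simp
      _ ≤ _ := by
          refine integral_mono ((integrable_const _).add hg).neg (integrable_kernel_sub hd hK hg x)
            fun y => ?_
          have h1 := neg_growth_le_kernel (x - y)
          have h2 := growth_sub_le x y
          simp only
          linarith
  unfold effectivePotential
  linarith

/-! ### Exponential integrability, support of the density, test functions. -/

/-- Exponential integrability of the effective potential. -/
lemma exists_integrable_exp_effectivePotential (hd : 1 ≤ d) {K β : ℝ} (hβ : 0 < β)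
    {V : Space d → ℝ} (hV : Continuous V) {μ : Measure (Space d)} [IsProbabilityMeasure μ]
    (hK : μ ≤ ENNReal.ofReal K • volume) (hg : Integrable (growth d) μ)
    (hA : ExpIntegrable V β) :
    ∃ t : ℝ, 0 < t ∧ Integrable (fun x => exp (-t * effectivePotential V μ x)) := by
  obtain ⟨n, hn, hn1⟩ := (hA.and (eventually_ge_atTop 1)).exists
  have hn0 : (0 : ℝ) < n := by exact_mod_cast hn1
  have ht : 0 < β * n := by positivity
  obtain ⟨c, hc⟩ := effectivePotential_ge hd V hK hg
  have hm : AEStronglyMeasurable (fun x => exp (-(β * n) * effectivePotential V μ x)) volume :=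
    ((measurable_effectivePotential hV μ).const_mul _).exp.aestronglyMeasurable
  refine ⟨β * n, ht, ?_⟩
  by_cases h2 : d ≤ 2
  · simp only [h2, if_true] at hn
    -- Near the origin log|x| does not control log(1 + |x|), so the unit ball is treated by
    -- boundedness of V; outside it, log(1 + |x|) ≤ log 2 + log|x|.
    obtain ⟨b, hb⟩ := (isCompact_closedBall (0 : Space d) 1).exists_bound_of_continuousOn
      hV.continuousOn
    have hball : Integrable ((Metric.closedBall (0 : Space d) 1).indicator
        fun _ => exp (β * n * (b / 2 + log 2 + c))) :=
      (integrable_indicator_iff Metric.isClosed_closedBall.measurableSet).2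
        (integrableOn_const measure_closedBall_lt_top.ne)
    refine (hball.add (hn.const_mul (exp (β * n * (log 2 + c))))).mono' hm
      (Eventually.of_forall fun x => ?_)
    rw [norm_of_nonneg (exp_pos _).le]
    have hx := hc x
    simp only [growth, h2, if_true] at hx
    simp only [Pi.add_apply]
    rcases le_total ‖x‖ 1 with h1 | h1
    · rw [indicator_of_mem (mem_closedBall_zero_iff.2 h1)]
      refine le_trans ?_ (le_add_of_nonneg_right (by positivity))
      rw [exp_le_exp]
      have hl : log (1 + ‖x‖) ≤ log 2 := log_le_log (by positivity) (by linarith)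
      have hbx := (abs_le.1 (hb x (mem_closedBall_zero_iff.2 h1))).1
      nlinarith
    · refine le_trans ?_ (le_add_of_nonneg_left (indicator_nonneg (fun _ _ => (exp_pos _).le) _))
      rw [← exp_add, exp_le_exp]
      have hl : log (1 + ‖x‖) ≤ log (2 * ‖x‖) := log_le_log (by positivity) (by linarith)
      rw [log_mul two_ne_zero (by linarith)] at hl
      nlinarith
  · simp only [h2, if_false] at hn
    refine (hn.const_mul (exp (β * n * c))).mono' hm (Eventually.of_forall fun x => ?_)
    rw [norm_of_nonneg (exp_pos _).le, ← exp_add, exp_le_exp]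
    have hx := hc x
    simp only [growth, h2, if_false] at hx
    nlinarith

/-- The set where the density does not vanish. -/
lemma HasBoundedDensity.exists_support {μ : Measure (Space d)} (hμ : HasBoundedDensity μ) :
    ∃ S : Set (Space d), MeasurableSet S ∧ μ Sᶜ = 0 ∧
      ∀ p : Space d → Prop, (∀ᵐ x ∂μ, p x) → ∀ᵐ x, x ∈ S → p x := by
  obtain ⟨ρ, hρ, -, rfl⟩ := hμ
  have hm : AEMeasurable (fun x => ENNReal.ofReal (ρ x)) volume := hρ.1.aemeasurable.ennreal_ofReal
  rw [withDensity_congr_ae hm.ae_eq_mk]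
  have hS : MeasurableSet {x | hm.mk _ x ≠ 0} :=
    (hm.measurable_mk (measurableSet_singleton 0)).compl
  refine ⟨{x | hm.mk _ x ≠ 0}, hS, ?_, fun p hp => (ae_withDensity_iff hm.measurable_mk).1 hp⟩
  rw [withDensity_apply _ hS.compl, setLIntegral_eq_zero_iff hS.compl hm.measurable_mk]
  exact Eventually.of_forall fun x hx => not_not.1 hx

/-- Lipschitz functions approximating an open set of full measure from inside. -/
lemma exists_lipschitz_approx {μ : Measure (Space d)} [IsProbabilityMeasure μ] {A : Set (Space d)}
    (hA : IsOpen A) (hAv : volume A ≠ ⊤) (hAμ : μ Aᶜ = 0) {ε : ℝ} (hε : 0 < ε) :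
    ∃ (f : Space d → ℝ) (L : NNReal), LipschitzWith L f ∧ (∀ x, 0 ≤ f x) ∧ (∀ x, f x ≤ 1) ∧
      (∀ x, x ∉ A → f x = 0) ∧ Integrable f ∧ 1 - ε ≤ ∫ x, f x ∂μ := by
  have hpos : ∀ n : ℕ, (0 : ℝ) < 1 / (n + 1) := fun n => by positivity
  have hlim := tendsto_lintegral_thickenedIndicator_of_isClosed μ hA.isClosed_compl hpos
    tendsto_one_div_add_atTop_nhds_zero_nat
  rw [hAμ] at hlim
  obtain ⟨n, hn⟩ := (hlim.eventually_lt_const (ENNReal.ofReal_pos.2 hε)).exists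
  -- The function 1 − g vanishes off A, and the μ-integral of g tends to μ(Aᶜ) = 0 as the thickening
  -- shrinks.
  set g := thickenedIndicator (hpos n) Aᶜ with hg
  have hgL := lipschitzWith_thickenedIndicator (hpos n) Aᶜ
  have hg1 : ∀ x, (g x : ℝ) ≤ 1 := fun x =>
    NNReal.coe_le_one.2 (thickenedIndicator_le_one (hpos n) Aᶜ x)
  have hfL : LipschitzWith (1 / (n + 1) : ℝ).toNNReal⁻¹ fun x => 1 - (g x : ℝ) := by
    refine LipschitzWith.of_dist_le_mul fun x y => ?_
    rw [dist_sub_left]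
    exact hgL.dist_le_mul x y
  have hf0 : ∀ x, x ∉ A → 1 - (g x : ℝ) = 0 := fun x hx => by
    rw [hg, thickenedIndicator_one (hpos n) Aᶜ hx]; simp
  have hgi : Integrable (fun x => (g x : ℝ)) μ := by
    refine (integrable_const (1 : ℝ)).mono' (by
      exact (NNReal.continuous_coe.comp g.continuous).aestronglyMeasurable)
      (Eventually.of_forall fun x => ?_)
    rw [norm_of_nonneg (NNReal.coe_nonneg _)]; exact hg1 x
  refine ⟨fun x => 1 - (g x : ℝ), _, hfL, fun x => sub_nonneg.2 (hg1 x),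
    fun x => sub_le_self _ (NNReal.coe_nonneg _), hf0, ?_, ?_⟩
  · have hi : Integrable (A.indicator fun _ => (1 : ℝ)) :=
      (integrable_indicator_iff hA.measurableSet).2 (integrableOn_const hAv)
    refine hi.mono' hfL.continuous.aestronglyMeasurable (Eventually.of_forall fun x => ?_)
    by_cases hx : x ∈ A
    · rw [indicator_of_mem hx, norm_of_nonneg (sub_nonneg.2 (hg1 x))]
      exact sub_le_self _ (NNReal.coe_nonneg _)
    · rw [indicator_of_notMem hx, hf0 x hx, norm_zero]
  · rw [integral_sub (integrable_const _) hgi]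
    have h1 : ∫ x, (g x : ℝ) ∂μ ≤ ε := by
      rw [integral_eq_lintegral_of_nonneg_ae (Eventually.of_forall fun x => NNReal.coe_nonneg _) hgi.1]
      refine ENNReal.toReal_le_of_le_ofReal hε.le ?_
      simp_rw [ENNReal.ofReal_coe_nnreal]
      exact hn.le
    simp
    linarith

/-! ### Coincidences, measurability and powers of N. -/

/-- Each coincidence of two points is a proper linear subspace, hence null, so the value of the
kernel at the origin plays no role. -/
lemma ae_injective (hd : 1 ≤ d) (N : ℕ) :
    ∀ᵐ X : Fin N → Space d, Function.Injective X := by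
  obtain ⟨e, he⟩ := exists_unit hd
  have h : ∀ i j : Fin N, i ≠ j → ∀ᵐ X : Fin N → Space d, X i ≠ X j := by
    intro i j hij
    let p : Submodule ℝ (Fin N → Space d) :=
      LinearMap.ker ((LinearMap.proj i : (Fin N → Space d) →ₗ[ℝ] Space d) - LinearMap.proj j)
    have hp : p ≠ ⊤ := by
      intro htop
      have hmem : (Pi.single i e : Fin N → Space d) ∈ p := htop ▸ Submodule.mem_top
      have h0 : e = 0 := by
        simpa [p, LinearMap.mem_ker, Pi.single_eq_of_ne hij.symm] using hmem
      rw [h0, norm_zero] at he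
      exact zero_ne_one he
    have h0 := Measure.addHaar_submodule (volume : Measure (Fin N → Space d)) p hp
    filter_upwards [compl_mem_ae_iff.2 h0] with X hX hXe
    exact hX (by simp [p, LinearMap.mem_ker, hXe])
  have h' : ∀ᵐ X : Fin N → Space d, ∀ i j, i ≠ j → X i ≠ X j :=
    ae_all_iff.2 fun i => ae_all_iff.2 fun j => by
      by_cases hij : i = j
      · simp [hij]
      · exact (h i j hij).mono fun _ hX _ => hX
  filter_upwards [h'] with X hX i j hij
  by_contra hne
  exact hX i j hne hij

lemma measurable_gibbsWeight {V : Space d → ℝ} (hV : Continuous V) (β : ℝ) (N : ℕ) :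
    Measurable (gibbsWeight V β N) := by
  have hV' := hV.measurable
  have hH : Measurable (hamiltonian (d := d) V N) := by
    unfold hamiltonian
    refine Measurable.add ?_ (by fun_prop)
    refine Finset.measurable_sum _ fun i _ => Finset.measurable_sum _ fun j _ => ?_
    split_ifs
    · exact measurable_kernel.comp ((measurable_pi_apply i).sub (measurable_pi_apply j))
    · exact measurable_const
  unfold gibbsWeight
  exact (hH.const_mul _).exp

section Scaling

variable {N : ℕ}

lemma rpow_scaling_mul_sq (hN : 1 ≤ N) :
    (N : ℝ) ^ min (2 / (d : ℝ) - 1) 0 * (N : ℝ) ^ 2 = (N : ℝ) ^ min 2 (2 / (d : ℝ) + 1) := by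
  have hN0 : (0 : ℝ) < N := by exact_mod_cast hN
  rw [← rpow_natCast (N : ℝ) 2, ← rpow_add hN0]
  congr 1
  push_cast
  rw [← min_add_add_right, min_comm]
  congr 1 <;> ring

lemma rpow_scaling_le_one (hN : 1 ≤ N) : (N : ℝ) ^ min (2 / (d : ℝ) - 1) 0 ≤ 1 :=
  rpow_le_one_of_one_le_of_nonpos (by exact_mod_cast hN) (min_le_right _ _)

lemma rpow_scaling_mul_self (hN : 1 ≤ N) :
    (N : ℝ) ^ min (2 / (d : ℝ) - 1) 0 * (N : ℝ) = (N : ℝ) ^ min (2 / (d : ℝ)) 1 := by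
  have hN0 : (0 : ℝ) < N := by exact_mod_cast hN
  nth_rw 2 [← rpow_one (N : ℝ)]
  rw [← rpow_add hN0, ← min_add_add_right]
  congr 2 <;> ring

/-- The reason for T = N^(2/d): the tail error, multiplied by N² and the temperature scaling, is
exactly of order N. -/
lemma rpow_scaling_mul_sq_mul_tail (hd : 1 ≤ d) (hN : 1 ≤ N) :
    (N : ℝ) ^ min (2 / (d : ℝ) - 1) 0 * (N : ℝ) ^ 2 *
      ((N : ℝ) ^ (2 / (d : ℝ))) ^ (-min 1 ((d : ℝ) / 2)) = N := by
  have hN0 : (0 : ℝ) < N := by exact_mod_cast hN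
  have hd0 : (0 : ℝ) < d := by exact_mod_cast hd
  rw [← rpow_natCast (N : ℝ) 2, ← rpow_add hN0, ← rpow_mul hN0.le, ← rpow_add hN0]
  have h : min (2 / (d : ℝ) - 1) 0 + ((2 : ℕ) : ℝ) + 2 / (d : ℝ) * -min 1 ((d : ℝ) / 2) = 1 := by
    have h1 : 2 / (d : ℝ) * min 1 ((d : ℝ) / 2) = min (2 / (d : ℝ)) 1 := by
      rw [mul_min_of_nonneg _ _ (by positivity)]
      congr 1
      · ring
      · field_simp
    have h2 : min (2 / (d : ℝ) - 1) 0 = min (2 / (d : ℝ)) 1 - 1 := by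
      rw [← min_sub_sub_right, sub_self]
    rw [mul_neg, h1, h2]
    push_cast
    ring
  rw [h, rpow_one]

lemma exists_scaled_truncKernel_zero_le (hd : 1 ≤ d) : ∃ C : ℝ, 0 ≤ C ∧ ∀ N : ℕ, 1 ≤ N →
    (N : ℝ) ^ min (2 / (d : ℝ) - 1) 0 * (N * truncKernel d ((N : ℝ) ^ (2 / (d : ℝ))) 0) ≤
      (if d ≤ 2 then 1 / (d : ℝ) * N * log N else 0) + C * N := by
  have hd0 : (0 : ℝ) < d := by exact_mod_cast hd
  have hT : ∀ N : ℕ, 1 ≤ N → (1 : ℝ) ≤ (N : ℝ) ^ (2 / (d : ℝ)) := fun N hN =>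
    one_le_rpow (by exact_mod_cast hN) (by positivity)
  by_cases h2 : d ≤ 2
  · refine ⟨0, le_rfl, fun N hN => ?_⟩
    have hN0 : (0 : ℝ) < N := by exact_mod_cast hN
    have h2' : (d : ℝ) ≤ 2 := by exact_mod_cast h2
    have h1 : min (2 / (d : ℝ) - 1) 0 = 0 := by
      apply min_eq_right
      rw [sub_nonneg, le_div_iff₀ hd0]; linarith
    rw [truncKernel_zero_of_le_two h2 (hT N hN), h1, rpow_zero, log_rpow hN0, if_pos h2]
    apply le_of_eq
    field_simp
    ring
  · obtain ⟨C, hC0, hC⟩ := exists_truncKernel_zero_le h2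
    refine ⟨C, hC0, fun N hN => ?_⟩
    have hN0 : (0 : ℝ) < N := by exact_mod_cast hN
    have h3 : (3 : ℝ) ≤ d := by exact_mod_cast (by omega : 3 ≤ d)
    have h1 : min (2 / (d : ℝ) - 1) 0 = 2 / (d : ℝ) - 1 := by
      apply min_eq_left
      rw [sub_nonpos, div_le_one hd0]; linarith
    rw [if_neg h2, zero_add, h1]
    calc (N : ℝ) ^ (2 / (d : ℝ) - 1) * (N * truncKernel d ((N : ℝ) ^ (2 / (d : ℝ))) 0)
        ≤ (N : ℝ) ^ (2 / (d : ℝ) - 1) *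
            (N * (C * ((N : ℝ) ^ (2 / (d : ℝ))) ^ ((d : ℝ) / 2 - 1))) := by
          gcongr; exact hC _ (hT N hN)
      _ = C * N * ((N : ℝ) ^ (2 / (d : ℝ) - 1) * (N : ℝ) ^ (2 / (d : ℝ) * ((d : ℝ) / 2 - 1))) := by
          rw [← rpow_mul hN0.le]; ring
      _ = C * N := by
          rw [← rpow_add hN0, show 2 / (d : ℝ) - 1 + 2 / (d : ℝ) * ((d : ℝ) / 2 - 1) = 0 by
            field_simp; ring, rpow_zero, mul_one]

/-- Lets N absorb all quantities depending on V, β, f or M into the threshold on N. -/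
lemma tendsto_rpow_scaling_mul_self (hd : 1 ≤ d) :
    Tendsto (fun N : ℕ => (N : ℝ) ^ min (2 / (d : ℝ) - 1) 0 * (N : ℝ)) atTop atTop := by
  have hd0 : (0 : ℝ) < d := by exact_mod_cast hd
  have h : Tendsto (fun N : ℕ => (N : ℝ) ^ min (2 / (d : ℝ)) 1) atTop atTop :=
    (tendsto_rpow_atTop (lt_min (by positivity) one_pos)).comp tendsto_natCast_atTop_atTop
  refine h.congr' ?_
  filter_upwards [eventually_ge_atTop 1] with N hN
  exact (rpow_scaling_mul_self hN).symm

end Scaling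

/-! ### Penalization, domination by a product, and conclusion. -/

/-- The truncated energy of the discrepancy penalizes the points outside the support of a test
function, at arbitrarily large linear rate. -/
lemma eventually_truncDiscrepancy_penalizes (hd : 1 ≤ d) {μ : Measure (Space d)}
    [IsProbabilityMeasure μ] (hg : Integrable (growth d) μ) {f : Space d → ℝ} {L : NNReal}
    (hfL : LipschitzWith L f) (hf0 : ∀ x, 0 ≤ f x) (hf1 : ∀ x, f x ≤ 1) (hfi : Integrable f)
    {M β : ℝ} (hM : 0 < M) (hβ : 0 < β) (hfμ : 1 - 1 / M ≤ ∫ x, f x ∂μ) :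
    ∀ᶠ N : ℕ in atTop, ∀ X : Fin N → Space d,
      -(β / 2) * (N : ℝ) ^ min (2 / (d : ℝ) - 1) 0 *
        truncDiscrepancy ((N : ℝ) ^ (2 / (d : ℝ))) (pointMeasure X) ((N : NNReal) • μ) ≤
      -(M * ∑ i, (1 - f (X i))) + 3 * N := by
  have hd0 : (0 : ℝ) < d := by exact_mod_cast hd
  obtain ⟨W, C, T₀, hW, -, hQ⟩ := exists_truncDiscrepancy_ge hfL hf0 hf1 hfi
    (show 0 < 1 / (2 * M) by positivity)
  have hTlim : Tendsto (fun N : ℕ => (N : ℝ) ^ (2 / (d : ℝ))) atTop atTop :=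
    (tendsto_rpow_atTop (by positivity)).comp tendsto_natCast_atTop_atTop
  filter_upwards [hTlim.eventually_ge_atTop T₀, eventually_ge_atTop 1,
    (tendsto_rpow_scaling_mul_self hd).eventually_ge_atTop (M ^ 2 * C / (2 * β * W))]
    with N hNT hN1 hNM X
  have hN0 : (0 : ℝ) < N := by exact_mod_cast hN1
  set n := (N : ℝ) ^ min (2 / (d : ℝ) - 1) 0 with hn
  have hn0 : 0 < n := rpow_pos_of_pos hN0 _
  -- This s turns the linear coefficient (β/2) n W · 2s into M. The three N on the right come from
  -- the approximation error (η = 1/(2M)), the quadratic term in s for N large, and the mass at most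
  -- 1/M that f misses.
  have hs : 0 ≤ M / (β * n * W) := by positivity
  have hmass : ((N : NNReal) • μ).real univ = N := by
    simp [measureReal_def]
  have h := hQ _ hNT (pointMeasure X) ((N : NNReal) • μ) (integrable_pointMeasure X measurable_growth)
    hg.smul_measure_nnreal (by rw [hmass, pointMeasure_real_univ]) _ hs
  rw [integral_pointMeasure X hfL.continuous.measurable, integral_smul_nnreal_measure,
    pointMeasure_real_univ] at h
  simp only [NNReal.smul_def, NNReal.coe_natCast, smul_eq_mul] at h
  set Q := truncDiscrepancy ((N : ℝ) ^ (2 / (d : ℝ))) (pointMeasure X) ((N : NNReal) • μ)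
  set F := ∑ i, f (X i) with hF
  set G := ∫ x, f x ∂μ
  have hsum : ∑ i, (1 - f (X i)) = N - F := by simp [Finset.sum_sub_distrib, hF]
  have h1 := mul_le_mul_of_nonneg_left h (show 0 ≤ β / 2 * n by positivity)
  have h2 : β / 2 * n * -(W * (2 * (M / (β * n * W)) * (F - N * G) +
      4 * (M / (β * n * W)) * (1 / (2 * M)) * N + (M / (β * n * W)) ^ 2 * C)) =
      -(M * (F - N * G)) - N - M ^ 2 * C / (2 * β * W) / n := by
    field_simp
    ring
  have h3 : M ^ 2 * C / (2 * β * W) / n ≤ N := by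
    rw [div_le_iff₀ hn0]; linarith
  have h4 : M * (1 - 1 / M) ≤ M * G := mul_le_mul_of_nonneg_left hfμ hM.le
  have h5 : M * (1 - 1 / M) = M - 1 := by field_simp
  rw [h2] at h1
  rw [hsum]
  nlinarith [mul_le_mul_of_nonneg_left h4 hN0.le]

/-- Domination of the Gibbs weight by a product. -/
lemma exists_eventually_gibbsWeight_le (hd : 1 ≤ d) {K : ℝ} (hK0 : 0 ≤ K) :
    ∃ C : ℝ, 0 ≤ C ∧ ∀ μ : Measure (Space d), μ ≤ ENNReal.ofReal K • volume →
      ∀ V : Space d → ℝ, Continuous V → IsEquilibriumMeasure V μ →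
      ∀ (f : Space d → ℝ) (L : NNReal), LipschitzWith L f → (∀ x, 0 ≤ f x) → (∀ x, f x ≤ 1) →
      Integrable f → ∀ M t β : ℝ, 0 < M → 0 < β → 1 - 1 / M ≤ ∫ x, f x ∂μ →
      ∀ᶠ N : ℕ in atTop, ∀ᵐ X : Fin N → Space d, gibbsWeight V β N X ≤
        exp (-(β / 2) * (N : ℝ) ^ min 2 (2 / (d : ℝ) + 1) * energy V μ +
          (if d ≤ 2 then β / (2 * (d : ℝ)) * (N : ℝ) * log (N : ℝ) else 0) +
          (3 + β / 2 * C) * N) *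
        ∏ i, exp (-t * effectivePotential V μ (X i) - M * (1 - f (X i))) := by
  have hd0 : (0 : ℝ) < d := by exact_mod_cast hd
  obtain ⟨κ, hκ0, hκ⟩ := nextOrderEnergy_ge hd
  obtain ⟨C₁, hC₁0, hC₁⟩ := exists_lintegral_tailKernel_le hd
  obtain ⟨C₂, hC₂0, hC₂⟩ := exists_scaled_truncKernel_zero_le hd
  -- Diagonal constant, self-interaction beyond N log N, and tail error. M and t enter only the
  -- threshold on N and the product, so they may later depend on V and β.
  refine ⟨κ + C₂ + 2 * (K * C₁), by positivity, ?_⟩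
  intro μ hK V hV hμ f L hfL hf0 hf1 hfi M t β hM hβ hfμ
  have := hμ.isProbabilityMeasure
  have hg := integrable_growth_of_integrable_kernel hμ.hasFiniteEnergy.integrable_kernel
  have hζ := hμ.ae_effectivePotential_nonneg hd hV hK
  filter_upwards [eventually_truncDiscrepancy_penalizes hd hg hfL hf0 hf1 hfi hM hβ hfμ,
    eventually_ge_atTop 1,
    (tendsto_rpow_scaling_mul_self hd).eventually_ge_atTop (t / β)] with N hpen hN1 hNt
  have hN0 : (0 : ℝ) < N := by exact_mod_cast hN1
  have hT1 : (1 : ℝ) ≤ (N : ℝ) ^ (2 / (d : ℝ)) :=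
    one_le_rpow (by exact_mod_cast hN1) (by positivity)
  have hζX : ∀ᵐ X : Fin N → Space d, ∀ i, 0 ≤ effectivePotential V μ (X i) :=
    ae_all_iff.2 fun i =>
      (Measure.tendsto_eval_ae_ae (μ := fun _ : Fin N => (volume : Measure (Space d)))
        (i := i)).eventually hζ
  filter_upwards [ae_injective hd N, hζX] with X hX hXζ
  have hF := hκ μ K (C₁ * ((N : ℝ) ^ (2 / (d : ℝ))) ^ (-min 1 ((d : ℝ) / 2))) _ hK0
    (by positivity) hT1 hK hg (hC₁ _ hT1) N X hX
  have hpen' := hpen X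
  have hzero := hC₂ N hN1
  have htail := rpow_scaling_mul_sq_mul_tail hd hN1
  have hscale := rpow_scaling_mul_sq (d := d) hN1
  have hn1 := rpow_scaling_le_one (d := d) hN1
  rw [← exp_sum, ← exp_add, gibbsWeight, exp_le_exp, hamiltonian_eq V μ, ← hscale]
  set n := (N : ℝ) ^ min (2 / (d : ℝ) - 1) 0 with hn
  have hn0 : 0 < n := rpow_pos_of_pos hN0 _
  set T := (N : ℝ) ^ (2 / (d : ℝ)) with hT
  set τ := T ^ (-min 1 ((d : ℝ) / 2))
  set Q := truncDiscrepancy T (pointMeasure X) ((N : NNReal) • μ)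
  set F := (∑ i, ∑ j, if i ≠ j then kernel d (X i - X j) else 0) -
    2 * (N : ℝ) * ∑ i, potential μ (X i) + N ^ 2 * selfEnergy μ
  set Z := ∑ i, effectivePotential V μ (X i) with hZ
  have hZ0 : 0 ≤ Z := Finset.sum_nonneg fun i _ => hXζ i
  have hsum : ∑ i, (-t * effectivePotential V μ (X i) - M * (1 - f (X i))) =
      -t * Z - M * ∑ i, (1 - f (X i)) := by
    rw [Finset.sum_sub_distrib, ← Finset.mul_sum, ← Finset.mul_sum]
  rw [hsum]
  -- The Gibbs weight confines by βnN ζ with βnN → ∞; since ζ ≥ 0, only tζ is kept.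
  have h1 : t * Z ≤ β * (n * N) * Z := by
    rw [div_le_iff₀ hβ] at hNt
    exact mul_le_mul_of_nonneg_right (by linarith) hZ0
  have h2 : n * (κ * N + N * truncKernel d T 0 + 2 * N ^ 2 * (K * (C₁ * τ))) ≤
      (if d ≤ 2 then 1 / (d : ℝ) * N * log N else 0) + (κ + C₂ + 2 * (K * C₁)) * N := by
    have e1 : n * (2 * N ^ 2 * (K * (C₁ * τ))) = 2 * (K * C₁) * N := by
      calc _ = 2 * (K * C₁) * (n * N ^ 2 * τ) := by ring
        _ = _ := by rw [htail]
    have e2 : n * (κ * N) ≤ κ * N := mul_le_of_le_one_left (by positivity) hn1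
    linarith
  have h3 : n * (Q - (κ * N + N * truncKernel d T 0 + 2 * N ^ 2 * (K * (C₁ * τ)))) ≤ n * F :=
    mul_le_mul_of_nonneg_left hF hn0.le
  have h4 : β / 2 * (if d ≤ 2 then 1 / (d : ℝ) * N * log N else 0) =
      if d ≤ 2 then β / (2 * (d : ℝ)) * (N : ℝ) * log (N : ℝ) else 0 := by
    split_ifs
    · field_simp
    · simp
  rw [← h4]
  have h5 := mul_le_mul_of_nonneg_left h2 (by positivity : 0 ≤ β / 2)
  have h6 := mul_le_mul_of_nonneg_left h3 (by positivity : 0 ≤ β / 2)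
  linarith

/-- The upper bound on the partition function. -/
lemma eventually_log_partitionFunction_le (hd : 1 ≤ d) {μ : Measure (Space d)}
    (hμb : HasBoundedDensity μ) :
    ∃ C : ℝ, ∀ V : Space d → ℝ, Continuous V → IsEquilibriumMeasure V μ →
      ∀ β : ℝ, 0 < β → ExpIntegrable V β → ∀ᶠ N : ℕ in atTop,
        Integrable (gibbsWeight V β N) volume ∧ 0 < partitionFunction V β N ∧
        log (partitionFunction V β N) ≤
          -(β / 2) * (N : ℝ) ^ min 2 (2 / (d : ℝ) + 1) * energy V μ
          + (if d ≤ 2 then β / (2 * (d : ℝ)) * (N : ℝ) * log (N : ℝ) else 0)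
          + C * (1 + β) * (N : ℝ) := by
  obtain ⟨K, hK0, hK⟩ := hμb.exists_le
  obtain ⟨S, hSm, hSμ, hS⟩ := hμb.exists_support
  obtain ⟨C, hC0, hC⟩ := exists_eventually_gibbsWeight_le hd hK0
  have hlog0 : 0 ≤ log ((volume S).toReal + 2) :=
    log_nonneg (by linarith [ENNReal.toReal_nonneg (a := volume S)])
  refine ⟨3 + C + log ((volume S).toReal + 2), fun V hV hμ β hβ hA => ?_⟩
  have := hμ.isProbabilityMeasure
  have hg := integrable_growth_of_integrable_kernel hμ.hasFiniteEnergy.integrable_kernel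
  have hζ := hμ.ae_effectivePotential_nonneg hd hV hK
  obtain ⟨t, ht, hti⟩ := exists_integrable_exp_effectivePotential hd hβ hV hK hg hA
  set J := ∫ x, exp (-t * effectivePotential V μ x) with hJ
  have hJ0 : 0 ≤ J := integral_nonneg fun x => (exp_pos _).le
  -- Since ζ = 0 almost everywhere on S, the integrand exp(−tζ) is 1 there and |S| ≤ J.
  have hStop : volume S ≠ ⊤ := by
    have h0 := hS _ (hμ.ae_effectivePotential_eq_zero hd hV hK)
    have h1 : volume S ≤ ∫⁻ x, ENNReal.ofReal (exp (-t * effectivePotential V μ x)) := by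
      rw [← lintegral_indicator_one hSm]
      refine lintegral_mono_ae ?_
      filter_upwards [h0] with x hx
      by_cases hxS : x ∈ S
      · simp [hxS, hx hxS]
      · simp [hxS]
    refine (h1.trans_lt ?_).ne
    rw [← ofReal_integral_eq_lintegral_ofReal hti (Eventually.of_forall fun x => (exp_pos _).le)]
    exact ENNReal.ofReal_lt_top
  obtain ⟨A, hSA, hAo, hAlt⟩ := S.exists_isOpen_lt_add hStop one_ne_zero
  have hAtop : volume A ≠ ⊤ := hAlt.ne_top
  have hAμ : μ Aᶜ = 0 := measure_mono_null (compl_subset_compl.2 hSA) hSμ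
  have hAreal : (volume A).toReal ≤ (volume S).toReal + 1 := by
    rw [← ENNReal.toReal_one, ← ENNReal.toReal_add hStop ENNReal.one_ne_top]
    exact ENNReal.toReal_mono (ENNReal.add_ne_top.2 ⟨hStop, ENNReal.one_ne_top⟩) hAlt.le
  -- J depends on V and β and must not reach the final constant; the rate M = 1 + J makes exp(−M) J
  -- ≤ 1.
  have hM : 0 < 1 + J := by linarith
  obtain ⟨f, L, hfL, hf0, hf1, hfA, hfi, hfμ⟩ :=
    exists_lipschitz_approx hAo hAtop hAμ (show 0 < 1 / (1 + J) by positivity)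
  set φ : Space d → ℝ := fun x => exp (-t * effectivePotential V μ x - (1 + J) * (1 - f x)) with hφ
  have hφm : Measurable φ :=
    (((measurable_effectivePotential hV μ).const_mul _).sub
      ((hfL.continuous.measurable.const_sub 1).const_mul _)).exp
  have hdom : Integrable (fun x => A.indicator (fun _ => (1 : ℝ)) x +
      exp (-(1 + J)) * exp (-t * effectivePotential V μ x)) :=
    ((integrable_indicator_iff hAo.measurableSet).2 (integrableOn_const hAtop)).add
      (hti.const_mul _)
  -- On A both exponents are nonpositive; off A, f = 0 and the full penalty exp(−M) is gained.
  have hφle : ∀ᵐ x, φ x ≤ A.indicator (fun _ => (1 : ℝ)) x +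
      exp (-(1 + J)) * exp (-t * effectivePotential V μ x) := by
    filter_upwards [hζ] with x hx
    by_cases hxA : x ∈ A
    · rw [indicator_of_mem hxA]
      refine le_add_of_le_of_nonneg (exp_le_one_iff.2 ?_) (by positivity)
      nlinarith [mul_nonneg ht.le hx, mul_nonneg hM.le (sub_nonneg.2 (hf1 x))]
    · rw [indicator_of_notMem hxA, zero_add, hφ, ← exp_add]
      simp only [hfA x hxA]
      apply le_of_eq
      ring_nf
  have hφi : Integrable φ := hdom.mono' hφm.aestronglyMeasurable (hφle.mono fun x hx => by
    rwa [norm_of_nonneg (exp_pos _).le])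
  have hφint : ∫ x, φ x ≤ (volume S).toReal + 2 := by
    have hexp : exp (-(1 + J)) * J ≤ 1 := by
      rw [exp_neg, inv_mul_le_iff₀ (exp_pos _)]
      linarith [add_one_le_exp (1 + J)]
    calc ∫ x, φ x ≤ ∫ x, (A.indicator (fun _ => (1 : ℝ)) x +
          exp (-(1 + J)) * exp (-t * effectivePotential V μ x)) := integral_mono_ae hφi hdom hφle
      _ = (volume A).toReal + exp (-(1 + J)) * J := by
          rw [integral_add ((integrable_indicator_iff hAo.measurableSet).2
            (integrableOn_const hAtop)) (hti.const_mul _), integral_const_mul,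
            integral_indicator hAo.measurableSet]
          simp [hJ, measureReal_def]
      _ ≤ _ := by linarith
  filter_upwards [hC μ hK V hV hμ f L hfL hf0 hf1 hfi (1 + J) t β hM hβ hfμ] with N hN
  set E := -(β / 2) * (N : ℝ) ^ min 2 (2 / (d : ℝ) + 1) * energy V μ +
    (if d ≤ 2 then β / (2 * (d : ℝ)) * (N : ℝ) * log (N : ℝ) else 0) with hE
  have hprod : Integrable (fun X : Fin N → Space d => exp (E + (3 + β / 2 * C) * N) *
      ∏ i, φ (X i)) :=
    (Integrable.fintype_prod (f := fun _ => φ) (μ := fun _ => volume) fun _ => hφi).const_mul _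
  have hint : Integrable (gibbsWeight V β N) volume :=
    hprod.mono' (measurable_gibbsWeight hV β N).aestronglyMeasurable (hN.mono fun X hX => by
      rw [norm_of_nonneg (show 0 ≤ gibbsWeight V β N X from (exp_pos _).le)]; exact hX)
  have hpos : 0 < partitionFunction V β N := integral_exp_pos hint
  refine ⟨hint, hpos, ?_⟩
  have hφ0 : 0 ≤ ∫ x, φ x := integral_nonneg fun x => (exp_pos _).le
  have hZ : partitionFunction V β N ≤
      exp (E + (3 + β / 2 * C) * N) * ((volume S).toReal + 2) ^ N := by
    calc partitionFunction V β N ≤ ∫ X : Fin N → Space d, exp (E + (3 + β / 2 * C) * N) *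
          ∏ i, φ (X i) := integral_mono_ae hint hprod hN
      _ = exp (E + (3 + β / 2 * C) * N) * (∫ x, φ x) ^ N := by
          rw [integral_const_mul, integral_fintype_prod_volume_eq_pow, Fintype.card_fin]
      _ ≤ _ := by gcongr
  have hS2 : 0 < (volume S).toReal + 2 := by linarith [ENNReal.toReal_nonneg (a := volume S)]
  have hlog := log_le_log hpos hZ
  rw [log_mul (exp_pos _).ne' (pow_pos hS2 N).ne', log_exp, log_pow] at hlog
  refine hlog.trans ?_
  have hN0 : (0 : ℝ) ≤ N := Nat.cast_nonneg N
  have h1 : 3 + β / 2 * C + log ((volume S).toReal + 2) ≤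
      (3 + C + log ((volume S).toReal + 2)) * (1 + β) := by
    nlinarith [mul_nonneg hβ.le hC0, mul_nonneg hβ.le hlog0]
  nlinarith [mul_le_mul_of_nonneg_right h1 hN0]

end LogCoulombGas

theorem corollary3p8 (d : ℕ) (hd : 1 ≤ d) (μ : Measure (LogCoulombGas.Space d))
    (hμ : LogCoulombGas.HasBoundedDensity μ) :
    ∃ C : ℝ, ∀ V : LogCoulombGas.Space d → ℝ, Continuous V →
      LogCoulombGas.IsEquilibriumMeasure V μ →
      ∀ β : ℝ, 0 < β → LogCoulombGas.ExpIntegrable V β →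
        ∀ᶠ N : ℕ in atTop,
          Integrable (LogCoulombGas.gibbsWeight V β N) volume ∧
          0 < LogCoulombGas.partitionFunction V β N ∧
          Real.log (LogCoulombGas.partitionFunction V β N) ≤
            -(β / 2) * (N : ℝ) ^ min 2 (2 / (d : ℝ) + 1) * LogCoulombGas.energy V μ
            + (if d ≤ 2 then β / (2 * (d : ℝ)) * (N : ℝ) * Real.log (N : ℝ) else 0)
            + C * (1 + β) * (N : ℝ) :=
  LogCoulombGas.eventually_log_partitionFunction_le hd hμ
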